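/- Theorem 4.5 (higher Stirling formula). Let $D=\mathbb C\setminus\{0,-1,-2,\dots\}$. There is a hierarchy of functions $G_n$ ($n=0,1,2,\dots$), holomorphic on $D$ and real and positive on $[1,\infty)$, such that (1) $G_{n+1}(z+1)=G_{n}(z)\,G_{n+1}(z)$ for $z\in D$, (2) $G_n(1)=1$, (3) $\frac{d^{n+1}}{dx^{n+1}}\log G_n(x+1)\ge 0$ for real $x\ge 0$, (4) $G_0(z)=z$, and it is the only one: any two such hierarchies agree on $D$ (these are the Vignéras multiple gamma functions). For $n\ge 1$ there is a (unique) holomorphic branch of $\log G_n(z+1)$ on $\mathbb C\setminus(-\infty,-1]$ which vanishes at $z=0$; $\log G_n(z+1)$ denotes this branch, and $\log(z+1)$ the principal one. Put $\binom{z}{k}=z(z-1)\cdots(z-k+1)/k!$, let $G_{n,j}(z)$ be the polynomials with $\binom{z-u}{n-1}=\sum_{j=0}^{n-1}G_{n,j}(z)u^j$, let $B_k$ be the Bernoulli numbers ($\frac{x}{e^x-1}=\sum_k B_k x^k/k!$), $\zeta$ the Riemann zeta function, $$F_{n,k}(z)=\Big(\frac{d}{dt}\Big)^{k}\Big\{\binom{-t}{n-1}\log\Big(\frac{z+t}{z+1}\Big)\Big\}\Big|_{t=1},$$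 $$S_n(z)=\Big\{\binom{z+1}{n}+\sum_{r=1}^{n}\frac{B_r}{r!}\Big(-\frac{d}{dz}\Big)^{r-1}\binom{z}{n-1}\Big\}\log(z+1)-\sum_{r=1}^{n}\Big\{\Big(-\frac{d}{dz}\Big)^{r-1}\binom{z}{n-1}\Big\}\frac{(z+1)^r-1}{r!\,r}-\sum_{j=0}^{n-1}G_{n,j}(z)\Big\{\zeta'(-j)+\frac1{(j+1)^2}\Big\}.$$ Let $n\ge1$ and $0<\delta<\pi$. Then, as $|z|\to\infty$ in the sector $|\arg z|<\pi-\delta$, $$\log G_n(z+1)\sim S_n(z)+\sum_{r=1}^{\infty}\frac{B_{2r}}{(2r)!}F_{n,2r-1}(z)$$ in the following sense: $F_{n,2m+1}(z)=O\big(z^{-2}F_{n,2m-1}(z)\big)$ for every $m$ with $2m>n$, and $$\log G_n(z+1)-S_n(z)-\sum_{r=1}^{m}\frac{B_{2r}}{(2r)!}F_{n,2r-1}(z)=o\Big(\frac{B_{2m}}{(2m)!}F_{n,2m-1}(z)\Big)$$ for every $m\ge1$ with $2m\ge n$. In particular, for $n=1$: $G_1=\Gamma$ on $D$, and, for $z\in\mathbb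 C\setminus(-\infty,-1]$, $S_1(z)=(z+\frac12)\log(z+1)-(z+1)-\zeta'(0)$ and $\frac{B_{2r}}{(2r)!}F_{1,2r-1}(z)=\frac{B_{2r}}{2r(2r-1)}(z+1)^{-(2r-1)}$ for $r\ge1$ (Stirling's formula). For $n=2$, in the same sectors, $\log G_2(z+1)=\big(\frac{z^2}{2}-\frac1{12}\big)\log(z+1)-\frac34z^2-\frac z2+\frac14-z\zeta'(0)+\zeta'(-1)+O(1/z)$ (the asymptotics of the Barnes $G$-function). -/

import Mathlib

open Polynomial Filter Asymptotics

/-- The complex plane without the non-positive integers `0, -1, -2, …`. -/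
def gammaDomain : Set ℂ := {z | ∀ k : ℕ, z ≠ -(k : ℂ)}

/-- The defining (generalized Bohr-Mollerup) properties of the hierarchy `G_0, G_1, G_2, …` of
Vignéras multiple gamma functions. The values at the non-positive integers, where the functions may
have poles, are left open. The properties `real` and `pos` say that the logarithm in `convex` is
the logarithm of a positive real number; `convex` is
`d^(n+1)/dx^(n+1) log G_n(x+1) ≥ 0` for real `x ≥ 0`. -/
structure IsMultipleGammaHierarchy (G : ℕ → ℂ → ℂ) : Prop where
  holomorphic : ∀ n, DifferentiableOn ℂ (G n) gammaDomain
  step : ∀ n, ∀ z ∈ gammaDomain, G (n + 1) (z + 1) = G n z * G (n + 1) z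
  one : ∀ n, G n 1 = 1
  real : ∀ n, ∀ x : ℝ, 0 ≤ x → (G n (x + 1)).im = 0
  pos : ∀ n, ∀ x : ℝ, 0 ≤ x → 0 < (G n (x + 1)).re
  convex : ∀ n, ∀ x : ℝ, 0 ≤ x →
    0 ≤ iteratedDeriv (n + 1) (fun t : ℝ => Real.log (G n (t + 1)).re) x
  zero : ∀ z ∈ gammaDomain, G 0 z = z

/-- The binomial coefficient `binom(X, k) = X (X - 1) ⋯ (X - k + 1) / k!` as a polynomial. -/
noncomputable def binomPoly (k : ℕ) : ℂ[X] := C ((k.factorial : ℂ)⁻¹) * descPochhammer ℂ k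

/-- `(-d/dz)^k binom(z, n-1)`. -/
noncomputable def binomDeriv (n k : ℕ) (z : ℂ) : ℂ :=
  (-1) ^ k * iteratedDeriv k (fun w => (binomPoly (n - 1)).eval w) z

/-- `G_{n,j}(z)`, the coefficient of `u^j` in `binom(z - u, n-1)`. -/
noncomputable def binomCoeff (n j : ℕ) (z : ℂ) : ℂ :=
  ((binomPoly (n - 1)).comp (C z - X)).coeff j

/-- `F_{n,k}(z)`, the `k`-th derivative of `t ↦ binom(-t, n-1) log((z+t)/(z+1))` at `t = 1`. -/
noncomputable def stirlingF (n k : ℕ) (z : ℂ) : ℂ :=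
  iteratedDeriv k
    (fun t : ℂ => (binomPoly (n - 1)).eval (-t) * Complex.log ((z + t) / (z + 1))) 1

/-- The leading part of the higher Stirling formula: the logarithmic term, the polynomial term and
the term with the values `ζ'(-j)`. -/
noncomputable def stirlingMain (n : ℕ) (z : ℂ) : ℂ :=
  ((binomPoly n).eval (z + 1)
      + ∑ r ∈ Finset.Icc 1 n, (_root_.bernoulli r : ℂ) / (r.factorial : ℂ) * binomDeriv n (r - 1) z)
    * Complex.log (z + 1)
  - ∑ r ∈ Finset.Icc 1 n,
      binomDeriv n (r - 1) z * (1 / ((r.factorial : ℂ) * (r : ℂ))) * ((z + 1) ^ r - 1)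
  - ∑ j ∈ Finset.range n,
      binomCoeff n j z * (deriv riemannZeta (-(j : ℂ)) + 1 / ((j : ℂ) + 1) ^ 2)

/-- The `r`-th term `B_{2r}/(2r)! F_{n,2r-1}(z)` of the asymptotic series (`r ≥ 1`). -/
noncomputable def stirlingTerm (n r : ℕ) (z : ℂ) : ℂ :=
  (_root_.bernoulli (2 * r) : ℂ) / ((2 * r).factorial : ℂ) * stirlingF n (2 * r - 1) z

/-- `|z| → ∞` in the sector `|arg z| < π - δ`. -/
noncomputable def atInftySector (δ : ℝ) : Filter ℂ :=
  Bornology.cobounded ℂ ⊓ 𝓟 {z | |Complex.arg z| < Real.pi - δ}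

/-- `L` is the branch of `z ↦ log g(z+1)` on the plane cut along `(-∞, -1]` which vanishes at
`z = 0` (it is unique, as the cut plane is connected). -/
structure IsLogBranch (g L : ℂ → ℂ) : Prop where
  holomorphic : DifferentiableOn ℂ L {z | z + 1 ∈ Complex.slitPlane}
  exp_eq : ∀ z, z + 1 ∈ Complex.slitPlane → Complex.exp (L z) = g (z + 1)
  zero : L 0 = 0

/-! Iterating the difference equation formally gives `log G_n(z+1) = -∑_k binom(-1-k, n-1)
log(z+1+k)`. With `u = z+1+k` the weight is `binom(z-u, n-1) = ∑_j G_{n,j}(z) u^j`, so the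
regularised sum is `∑_j G_{n,j}(z) ζ'(-j, z+1)`, where `ζ'(s, a)` is the `s`-derivative of the
Hurwitz zeta function. Subtracting `ζ'(-j)` from each factor makes it vanish at `z = 0`. This is
`logMultGamma`, and everything is read off from it.

The values `ζ'(-j, a)` are not obtained from a Hurwitz zeta function but defined by Euler-Maclaurin
summation of `a ↦ a^j log a` (`hurwitzLog`). The one-step error of that formula is estimated by
Taylor expansion (`norm_bernoulliDefect_le`), and away from the negative axis the errors sum to a
holomorphic function with power decay. The truncation order is irrelevant (`hurwitzLog_eq`). The
value at `a = 1` is `ζ'(-j)`, because the same summation applied to `a^(-s)` represents `ζ(s)` near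
`s = -j` and can be differentiated in `s` (`hurwitzLog_one`).

Inserting the expansion into `logMultGamma` gives an exact formula with remainder
(`logMultGamma_eq`); the polynomial identity `sum_binomCoeff_primitive` identifies the coefficient
of `log(z+1)`. Every term of the series has an exact order in `z` (`isTheta_stirlingTerm`), so a
sufficiently long expansion yields the little-o statement.

The expansion also characterises the hierarchy. By Cauchy's estimates the derivatives of
`logMultGamma n` of order at least `n+1` tend to `0` along the positive axis. With the difference
equation this forces their alternating signs (`iteratedDeriv_logMultGamma_sign`) and the reality of
the functions (`logMultGamma_im`). Uniqueness is a Bohr-Mollerup argument: two solutions differ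
logarithmically by a periodic function with a nonnegative derivative of some order, and such a
function is constant (`IsDerivTower.eq_of_periodic`). The functions are continued from the slit
plane to the whole domain by dividing by the product that the functional equation prescribes, and
`G_1 = Γ` is the classical Bohr-Mollerup theorem. -/

/-! ### Derivative towers -/

/-- `f 0, f 1, f 2, …` are the successive derivatives of `f 0` on `s`. -/
def IsDerivTower {𝕜 E : Type*} [NontriviallyNormedField 𝕜] [NormedAddCommGroup E]
    [NormedSpace 𝕜 E] (s : Set 𝕜) (f : ℕ → 𝕜 → E) : Prop :=
  ∀ i, ∀ x ∈ s, HasDerivAt (f i) (f (i + 1) x) x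

namespace IsDerivTower

section Basic

variable {𝕜 E : Type*} [NontriviallyNormedField 𝕜] [NormedAddCommGroup E] [NormedSpace 𝕜 E]
  {s t : Set 𝕜} {f g : ℕ → 𝕜 → E}

theorem mono (h : IsDerivTower s f) (hst : t ⊆ s) : IsDerivTower t f :=
  fun i x hx => h i x (hst hx)

theorem shift (h : IsDerivTower s f) (k : ℕ) : IsDerivTower s (fun i => f (i + k)) := by
  intro i x hx
  have := h (i + k) x hx
  rwa [show i + k + 1 = i + 1 + k by omega] at this

theorem sub (hf : IsDerivTower s f) (hg : IsDerivTower s g) :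
    IsDerivTower s (fun i x => f i x - g i x) :=
  fun i x hx => (hf i x hx).sub (hg i x hx)

/-- The bridge from explicit formulas to `iteratedDeriv`. Openness of `s` turns each equality into
one near `x`, which can then be differentiated again. -/
theorem iteratedDeriv_eq (h : IsDerivTower s f) (hs : IsOpen s) (k : ℕ) {x : 𝕜} (hx : x ∈ s) :
    iteratedDeriv k (f 0) x = f k x := by
  induction k generalizing x with
  | zero => simp
  | succ k ih =>
    rw [iteratedDeriv_succ]
    have : iteratedDeriv k (f 0) =ᶠ[nhds x] f k :=
      Filter.eventually_of_mem (hs.mem_nhds hx) fun y hy => ih hy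
    rw [this.deriv_eq]
    exact (h k x hx).deriv

end Basic

theorem of_contDiffOn {𝕜 E : Type*} [NontriviallyNormedField 𝕜] [NormedAddCommGroup E]
    [NormedSpace 𝕜 E] {s : Set 𝕜} {f : 𝕜 → E} (hs : IsOpen s)
    (hf : ContDiffOn 𝕜 (⊤ : ℕ∞) f s) : IsDerivTower s (fun i => iteratedDeriv i f) := by
  intro i x hx
  change HasDerivAt (iteratedDeriv i f) (iteratedDeriv (i + 1) f x) x
  rw [iteratedDeriv_succ]
  refine DifferentiableAt.hasDerivAt ?_
  have h := (hf.differentiableOn_iteratedDerivWithin (m := i) (by exact_mod_cast ENat.natCast_lt_top i)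
    hs.uniqueDiffOn) x hx
  have h2 := h.differentiableAt (hs.mem_nhds hx)
  refine h2.congr_of_eventuallyEq ?_
  filter_upwards [hs.mem_nhds hx] with y hy
  exact (iteratedDerivWithin_of_isOpen hs hy).symm

theorem of_differentiableOn {s : Set ℂ} {f : ℂ → ℂ} (hs : IsOpen s)
    (hf : DifferentiableOn ℂ f s) : IsDerivTower s (fun i => iteratedDeriv i f) :=
  of_contDiffOn hs (hf.contDiffOn hs)

theorem re {s : Set ℂ} {f : ℕ → ℂ → ℂ} (h : IsDerivTower s f) :
    IsDerivTower {x : ℝ | (x : ℂ) ∈ s} (fun i (x : ℝ) => (f i x).re) :=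
  fun i x hx => (h i x hx).real_of_complex

theorem im {s : Set ℂ} {f : ℕ → ℂ → ℂ} (h : IsDerivTower s f) :
    IsDerivTower {x : ℝ | (x : ℂ) ∈ s} (fun i (x : ℝ) => (f i x).im) := by
  intro i x hx
  -- The imaginary part of `w` is the real part of `-i w`.
  have := ((h i x hx).mul_const (-Complex.I)).real_of_complex
  simpa using this

/-- Taylor's formula with the remainder estimated by the norm of the last derivative. -/
theorem norm_sub_taylor_le {E : Type*} [NormedAddCommGroup E] [NormedSpace ℝ E] (m : ℕ) {C : ℝ}
    {g : ℕ → ℝ → E} (hg : IsDerivTower (Set.Icc 0 1) g) (hC : ∀ t ∈ Set.Icc (0 : ℝ) 1, ‖g m t‖ ≤ C) :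
    ∀ t ∈ Set.Icc (0 : ℝ) 1,
      ‖g 0 t - ∑ i ∈ Finset.range m, (t ^ i / (i.factorial : ℝ)) • g i 0‖ ≤ C := by
  induction m generalizing g with
  | zero => intro t ht; simpa using hC t ht
  | succ m ih =>
    intro t ht
    -- The derivative of the Taylor remainder is the Taylor remainder of the derivative, one order
    -- lower. The mean value inequality on `[0, t]` with `t ≤ 1` transfers the bound; the factorial
    -- that could be gained is given up.
    have h1 := ih (hg.shift 1) hC
    set h : ℝ → E := fun t => g 0 t - ∑ i ∈ Finset.range (m + 1), (t ^ i / (i.factorial : ℝ)) • g i 0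
      with hh
    have hd : ∀ x ∈ Set.Icc (0 : ℝ) 1, HasDerivAt h
        (g 1 x - ∑ i ∈ Finset.range m, (x ^ i / (i.factorial : ℝ)) • g (i + 1) 0) x := by
      intro x hx
      refine (hg 0 x hx).sub ?_
      have : HasDerivAt (fun t : ℝ => ∑ i ∈ Finset.range (m + 1), (t ^ i / (i.factorial : ℝ)) • g i 0)
          (∑ i ∈ Finset.range (m + 1), ((i : ℝ) * x ^ (i - 1) / (i.factorial : ℝ)) • g i 0) x :=
        HasDerivAt.fun_sum fun i _ => ((hasDerivAt_pow i x).div_const _).smul_const _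
      convert this using 1
      rw [Finset.sum_range_succ']
      simp only [Nat.cast_zero, zero_mul, zero_div, zero_smul, add_zero]
      refine Finset.sum_congr rfl fun i _ => ?_
      congr 1
      rw [Nat.factorial_succ]
      push_cast
      have : (i.factorial : ℝ) ≠ 0 := by positivity
      have : (i : ℝ) + 1 ≠ 0 := by positivity
      field_simp
    have h0 : h 0 = 0 := by
      simp [hh, Finset.sum_range_succ']
    have h2 : ‖h t - h 0‖ ≤ C * (t - 0) := by
      refine norm_image_sub_le_of_norm_deriv_le_segment' (a := 0) (b := 1) (fun x hx =>
        (hd x hx).hasDerivWithinAt) (fun x hx => ?_) t ht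
      exact h1 x ⟨hx.1, hx.2.le⟩
    rw [h0, sub_zero] at h2
    have hC0 : 0 ≤ C := (norm_nonneg _).trans (hC t ht)
    refine h2.trans ?_
    nlinarith [ht.2]

end IsDerivTower

/-! ### The Euler-Maclaurin defect -/

/-- `∑_{r ≤ N} B_r / r! f_r(a)`. -/
noncomputable def bernoulliSum (N : ℕ) (f : ℕ → ℂ → ℂ) (a : ℂ) : ℂ :=
  ∑ r ∈ Finset.range (N + 1), (_root_.bernoulli r : ℂ) / (r.factorial : ℂ) * f r a

/-- The error in the Euler-Maclaurin formula over `[a, a + 1]`. -/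
noncomputable def bernoulliDefect (N : ℕ) (f : ℕ → ℂ → ℂ) (a : ℂ) : ℂ :=
  bernoulliSum N f (a + 1) - bernoulliSum N f a - f 1 a

/-- The constant in the estimate of the Euler-Maclaurin defect. -/
noncomputable def bernoulliConst (N : ℕ) : ℝ :=
  ∑ r ∈ Finset.range (N + 1), ‖(_root_.bernoulli r : ℂ) / (r.factorial : ℂ)‖

theorem bernoulliConst_nonneg (N : ℕ) : 0 ≤ bernoulliConst N :=
  Finset.sum_nonneg fun _ _ => norm_nonneg _

/-- In the sum over the Taylor expansions all terms but `g 1` cancel. -/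
theorem sum_bernoulli_taylor (N : ℕ) (g : ℕ → ℂ) :
    ∑ r ∈ Finset.range (N + 1), (_root_.bernoulli r : ℂ) / (r.factorial : ℂ) *
      ∑ i ∈ Finset.range (N + 1 - r), 1 / ((i + 1).factorial : ℂ) * g (r + i + 1) = g 1 := by
  -- Regroup the double sum by the total order `m = r + i`.
  have key := Finset.sum_range_diag_flip (N + 1) (fun r i : ℕ =>
    (_root_.bernoulli r : ℂ) / (r.factorial : ℂ) * (1 / ((i + 1).factorial : ℂ) * g (r + i + 1)))
  simp only [Finset.mul_sum]
  rw [← key]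
  have h : ∀ m ∈ Finset.range (N + 1), (∑ k ∈ Finset.range (m + 1),
      (_root_.bernoulli k : ℂ) / (k.factorial : ℂ) *
        (1 / ((m - k + 1).factorial : ℂ) * g (k + (m - k) + 1))) = if m = 0 then g 1 else 0 := by
    intro m _
    have e : ∀ k ∈ Finset.range (m + 1), (_root_.bernoulli k : ℂ) / (k.factorial : ℂ) *
        (1 / ((m - k + 1).factorial : ℂ) * g (k + (m - k) + 1)) =
        (((m + 1).choose k : ℚ) * _root_.bernoulli k : ℚ) * (g (m + 1) / ((m + 1).factorial : ℂ)) := by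
      intro k hk
      have hk : k ≤ m := by simpa [Nat.lt_succ_iff] using hk
      have h1 := Nat.choose_mul_factorial_mul_factorial (show k ≤ m + 1 by omega)
      rw [show m + 1 - k = m - k + 1 by omega] at h1
      rw [show k + (m - k) + 1 = m + 1 by omega]
      have h2 : ((m + 1).choose k : ℂ) * (k.factorial : ℂ) * ((m - k + 1).factorial : ℂ)
          = ((m + 1).factorial : ℂ) := by exact_mod_cast h1
      have a1 : (k.factorial : ℂ) ≠ 0 := by exact_mod_cast k.factorial_ne_zero
      have a2 : ((m - k + 1).factorial : ℂ) ≠ 0 := by exact_mod_cast Nat.factorial_ne_zero _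
      have a3 : ((m + 1).factorial : ℂ) ≠ 0 := by exact_mod_cast Nat.factorial_ne_zero _
      push_cast
      rw [← h2] at a3 ⊢
      have a4 : ((m + 1).choose k : ℂ) ≠ 0 := by
        intro h; rw [h] at a3; simp at a3
      field_simp
    -- The Bernoulli recursion `∑_{k ≤ m} binom(m+1, k) B_k = 0` for `m ≥ 1` kills all orders but
    -- the first.
    rw [Finset.sum_congr rfl e, ← Finset.sum_mul, ← Rat.cast_sum, _root_.sum_bernoulli]
    by_cases hm : m = 0
    · subst hm; simp
    · simp [hm]
  rw [Finset.sum_congr rfl h]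
  simp

/-- Each `f r (a + 1)` is expanded about `a` through the derivative of index `N + 1`, so that all
Taylor remainders are controlled by the same `f (N + 2)`. The polynomial parts collapse by
`sum_bernoulli_taylor`; no Bernoulli polynomials or integrals are needed. -/
theorem norm_bernoulliDefect_le (N : ℕ) {f : ℕ → ℂ → ℂ} {s : Set ℂ} (hf : IsDerivTower s f) {a : ℂ}
    (ha : ∀ t ∈ Set.Icc (0 : ℝ) 1, a + t ∈ s) {b : ℝ}
    (hb : ∀ t ∈ Set.Icc (0 : ℝ) 1, ‖f (N + 2) (a + t)‖ ≤ b) :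
    ‖bernoulliDefect N f a‖ ≤ bernoulliConst N * b := by
  have hg : ∀ r, IsDerivTower (Set.Icc 0 1) (fun i (t : ℝ) => f (i + r) (a + t)) := by
    intro r i x hx
    have h := hf.shift r i (a + x) (ha x hx)
    have h' : HasDerivAt (fun w : ℂ => f (i + r) (a + w)) (f (i + 1 + r) (a + x)) (x : ℂ) := by
      simpa using h.comp_const_add a (x : ℂ)
    exact h'.comp_ofReal
  set T : ℕ → ℂ := fun r => f r (a + 1) - f r a -
    ∑ i ∈ Finset.range (N + 1 - r), 1 / ((i + 1).factorial : ℂ) * f (r + i + 1) a with hT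
  have hTb : ∀ r ∈ Finset.range (N + 1), ‖T r‖ ≤ b := by
    intro r hr
    have hr : r ≤ N := by simpa [Nat.lt_succ_iff] using hr
    have := (hg r).norm_sub_taylor_le (N + 1 - r + 1) (C := b) (by
      intro t ht
      rw [show N + 1 - r + 1 + r = N + 2 by omega]
      exact hb t ht) 1 (by simp)
    refine le_of_eq_of_le (congrArg _ ?_) this
    rw [Finset.sum_range_succ', hT]
    simp only [Complex.ofReal_one, zero_add, one_pow, Complex.ofReal_zero, add_zero,
      Nat.factorial_zero, Nat.cast_one, div_one, one_smul, Complex.real_smul]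
    rw [add_comm (∑ i ∈ _, _) (f r a), ← sub_sub]
    congr 1
    refine Finset.sum_congr rfl fun i _ => ?_
    push_cast
    rw [show i + 1 + r = r + i + 1 by omega]
  have hdef : bernoulliDefect N f a =
      ∑ r ∈ Finset.range (N + 1), (_root_.bernoulli r : ℂ) / (r.factorial : ℂ) * T r := by
    have := sum_bernoulli_taylor N (fun i => f i a)
    simp only [hT, mul_sub, Finset.sum_sub_distrib]
    rw [this]
    rfl
  rw [hdef, bernoulliConst, Finset.sum_mul]
  refine (norm_sum_le _ _).trans (Finset.sum_le_sum fun r hr => ?_)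
  rw [norm_mul]
  exact mul_le_mul_of_nonneg_left (hTb r hr) (norm_nonneg _)

/-! ### Periodic functions on a half-line -/

/-- For a natural number `k ≥ x`, `f x ≤ f (y + k) = f y`; then exchange `x` and `y`. -/
theorem eq_of_periodic_of_monotone {f : ℝ → ℝ} (hp : ∀ x, 0 < x → f (x + 1) = f x)
    (hm : MonotoneOn f (Set.Ioi 0)) {x y : ℝ} (hx : 0 < x) (hy : 0 < y) : f x = f y := by
  have hk : ∀ k : ℕ, ∀ x, 0 < x → f (x + k) = f x := by
    intro k
    induction k with
    | zero => simp
    | succ k ih =>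
      intro x hx
      push_cast
      rw [← add_assoc, hp _ (by positivity), ih x hx]
  have main : ∀ x y : ℝ, 0 < x → 0 < y → f x ≤ f y := by
    intro x y hx hy
    obtain ⟨k, hk'⟩ := exists_nat_ge x
    rw [← hk k y hy]
    exact hm hx (show (0 : ℝ) < y + k by positivity) (by linarith)
  exact le_antisymm (main x y hx hy) (main y x hy hx)

theorem deriv_eq_zero_of_periodic {f f' : ℝ → ℝ} (hp : ∀ x, 0 < x → f (x + 1) = f x)
    (hd : ∀ x, 0 < x → HasDerivAt f (f' x) x) (h0 : ∀ x, 0 < x → 0 ≤ f' x) :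
    ∀ x, 0 < x → f' x = 0 := by
  have hm : MonotoneOn f (Set.Ioi 0) := by
    refine monotoneOn_of_deriv_nonneg (convex_Ioi 0)
      (fun x hx => (hd x hx).continuousAt.continuousWithinAt) ?_ ?_
    · intro x hx
      rw [interior_Ioi] at hx
      exact (hd x hx).differentiableAt.differentiableWithinAt
    · intro x hx
      rw [interior_Ioi] at hx
      rw [(hd x hx).deriv]
      exact h0 x hx
  intro x hx
  have h1 : HasDerivAt f 0 x := by
    refine (hasDerivAt_const x (f x)).congr_of_eventuallyEq ?_
    filter_upwards [Ioi_mem_nhds hx] with y hy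
    exact eq_of_periodic_of_monotone hp hm hy hx
  exact (hd x hx).unique h1

theorem IsDerivTower.step {𝕜 E : Type*} [NontriviallyNormedField 𝕜] [NormedAddCommGroup E]
    [NormedSpace 𝕜 E] {s : Set 𝕜} {f g : ℕ → 𝕜 → E} (hf : IsDerivTower s f)
    (hg : IsDerivTower s g) (hs : IsOpen s) (hs1 : ∀ x ∈ s, x + 1 ∈ s)
    (h : ∀ x ∈ s, f 0 (x + 1) - f 0 x = g 0 x) (i : ℕ) :
    ∀ x ∈ s, f i (x + 1) - f i x = g i x := by
  induction i with
  | zero => exact h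
  | succ i ih =>
    intro x hx
    have h1 : HasDerivAt (fun y => f i (y + 1) - f i y) (f (i + 1) (x + 1) - f (i + 1) x) x :=
      ((hf i (x + 1) (hs1 x hx)).comp_add_const x 1).sub (hf i x hx)
    refine (h1.congr_of_eventuallyEq ?_).unique (hg i x hx)
    filter_upwards [hs.mem_nhds hx] with y hy
    exact (ih y hy).symm

theorem IsDerivTower.periodic {f : ℕ → ℝ → ℝ} (hf : IsDerivTower (Set.Ioi 0) f)
    (h : ∀ x, 0 < x → f 0 (x + 1) = f 0 x) (i : ℕ) : ∀ x, 0 < x → f i (x + 1) = f i x := by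
  intro x hx
  have hg : IsDerivTower (Set.Ioi (0 : ℝ)) (fun _ _ => (0 : ℝ)) := fun i x _ => hasDerivAt_const x 0
  exact sub_eq_zero.1 (hf.step hg isOpen_Ioi (fun x hx => lt_trans hx (lt_add_one x))
    (fun x hx => sub_eq_zero.2 (h x hx)) i x hx)

theorem IsDerivTower.periodic_natCast {f : ℕ → ℝ → ℝ} (hf : IsDerivTower (Set.Ioi 0) f)
    (h : ∀ x, 0 < x → f 0 (x + 1) = f 0 x) (i : ℕ) {x : ℝ} (hx : 0 < x) (k : ℕ) :
    f i (x + k) = f i x := by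
  induction k with
  | zero => simp
  | succ k ih =>
    push_cast
    rw [← add_assoc, hf.periodic h i _ (by positivity), ih]

/-- A periodic function with a derivative that is nowhere negative is constant. -/
theorem IsDerivTower.eq_of_periodic {f : ℕ → ℝ → ℝ} (hf : IsDerivTower (Set.Ioi 0) f)
    (h : ∀ x, 0 < x → f 0 (x + 1) = f 0 x) {n : ℕ} (hn : ∀ x, 0 < x → 0 ≤ f (n + 1) x)
    {x y : ℝ} (hx : 0 < x) (hy : 0 < y) : f 0 x = f 0 y := by
  have hconst : ∀ g g' : ℝ → ℝ, (∀ x, 0 < x → HasDerivAt g (g' x) x) → (∀ x, 0 < x → g' x = 0) →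
      ∀ x y, 0 < x → 0 < y → g x = g y := by
    intro g g' hg hg' x y hx hy
    refine (convex_Ioi (0 : ℝ)).is_const_of_fderivWithin_eq_zero (𝕜 := ℝ) (fun x hx => 
      (hg x hx).differentiableAt.differentiableWithinAt) (fun x hx => ?_) hx hy
    rw [fderivWithin_of_isOpen isOpen_Ioi hx]
    ext
    simp [(hg x hx).deriv, hg' x hx]
  -- Descent through the orders: once a derivative vanishes, the one below is constant, hence of
  -- constant sign. The next lower one is then periodic and monotone, up to a sign, so that constant
  -- is `0`.
  have main : ∀ i, i ≤ n → ∀ x, 0 < x → f (n - i + 1) x = 0 := by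
    intro i
    induction i with
    | zero =>
      intro _
      exact deriv_eq_zero_of_periodic (hf.periodic h n) (hf n) hn
    | succ i ih =>
      intro hi
      have h1 := ih (by omega)
      rw [show n - i + 1 = n - (i + 1) + 1 + 1 by omega] at h1
      set k := n - (i + 1) with hk
      have hc := hconst _ _ (hf (k + 1)) h1
      rcases le_total 0 (f (k + 1) 1) with hs | hs
      · exact deriv_eq_zero_of_periodic (hf.periodic h k) (hf k)
          (fun x hx => by rw [hc x 1 hx one_pos]; exact hs)
      · intro x hx
        have := deriv_eq_zero_of_periodic (f := fun x => - f k x) (f' := fun x => - f (k + 1) x)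
          (fun x hx => by rw [hf.periodic h k x hx]) (fun x hx => (hf k x hx).neg)
          (fun x hx => by rw [hc x 1 hx one_pos]; linarith) x hx
        linarith
  have h1 := main n le_rfl
  rw [Nat.sub_self] at h1
  exact hconst _ _ (hf 0) h1 x y hx hy

/-! ### The derivatives of `a ↦ ∫ a ^ j log a` -/

/-- The coefficient of the logarithm in `logTower`. -/
noncomputable def logTowerAlpha (j : ℕ) : ℕ → ℂ
  | 0 => 1 / ((j : ℂ) + 1)
  | r + 1 => ((j : ℂ) + 1 - r) * logTowerAlpha j r

/-- The coefficient of the pure power in `logTower`. -/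
noncomputable def logTowerBeta (j : ℕ) : ℕ → ℂ
  | 0 => -(1 / ((j : ℂ) + 1) ^ 2)
  | r + 1 => ((j : ℂ) + 1 - r) * logTowerBeta j r + logTowerAlpha j r

/-- The derivatives of the primitive `a ^ (j + 1) / (j + 1) * log a - a ^ (j + 1) / (j + 1) ^ 2`
of `a ^ j * log a`. -/
noncomputable def logTower (j r : ℕ) (a : ℂ) : ℂ :=
  a ^ ((j : ℤ) + 1 - r) * (logTowerAlpha j r * Complex.log a + logTowerBeta j r)

theorem isDerivTower_logTower (j : ℕ) : IsDerivTower Complex.slitPlane (logTower j) := by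
  intro r a ha
  have h0 : a ≠ 0 := Complex.slitPlane_ne_zero ha
  have h1 := hasDerivAt_zpow ((j : ℤ) + 1 - r) a (Or.inl h0)
  have h2 := (((Complex.hasStrictDerivAt_log ha).hasDerivAt.const_mul
    (logTowerAlpha j r)).add_const (logTowerBeta j r))
  refine (h1.mul h2).congr_deriv ?_
  have e : a ^ ((j : ℤ) + 1 - r) = a ^ ((j : ℤ) + 1 - r - 1) * a := by
    rw [← zpow_add_one₀ h0]; congr 1; ring
  rw [logTower, show ((j : ℤ) + 1 - ((r + 1 : ℕ) : ℤ)) = (j : ℤ) + 1 - r - 1 by push_cast; ring, e,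
    logTowerAlpha, logTowerBeta]
  push_cast
  field_simp
  ring

theorem logTower_one (j : ℕ) (a : ℂ) : logTower j 1 a = a ^ j * Complex.log a := by
  have : (j : ℂ) + 1 ≠ 0 := by exact_mod_cast j.succ_ne_zero
  have e : (j : ℤ) + 1 - (1 : ℕ) = j := by push_cast; ring
  rw [logTower, e, zpow_natCast]
  simp only [logTowerAlpha, logTowerBeta]
  field_simp
  push_cast
  ring

theorem logTower_zero (j : ℕ) (a : ℂ) :
    logTower j 0 a = a ^ (j + 1) / ((j : ℂ) + 1) * Complex.log a - a ^ (j + 1) / ((j : ℂ) + 1) ^ 2 := by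
  have e : (j : ℤ) + 1 - (0 : ℕ) = (j + 1 : ℕ) := by push_cast; ring
  rw [logTower, e, zpow_natCast]
  simp only [logTowerAlpha, logTowerBeta]
  ring

/-- The factor `j + 1 - r` vanishes at `r = j + 1`, so the logarithm disappears from the next
derivative on and only a negative power remains. -/
theorem logTowerAlpha_eq_zero {j r : ℕ} (h : j + 2 ≤ r) : logTowerAlpha j r = 0 := by
  induction r, h using Nat.le_induction with
  | base => simp [logTowerAlpha]
  | succ r _ ih => rw [logTowerAlpha, ih, mul_zero]

theorem logTower_of_le {j r : ℕ} (h : j + 2 ≤ r) (a : ℂ) :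
    logTower j r a = logTowerBeta j r * (a ^ (r - j - 1))⁻¹ := by
  have e : (j : ℤ) + 1 - r = -((r - j - 1 : ℕ) : ℤ) := by omega
  rw [logTower, logTowerAlpha_eq_zero h, e, zpow_neg, zpow_natCast]
  ring

/-! ### Wedges around the negative real axis -/

/-- A quantitative form of staying away from the negative real axis. -/
def wedge (c : ℝ) : Set ℂ := {a | ∀ t : ℝ, 0 ≤ t → c * (‖a‖ + t) ≤ ‖a + t‖}

theorem wedge_add {c : ℝ} (hc : 0 ≤ c) {a : ℂ} (ha : a ∈ wedge c) {s : ℝ} (hs : 0 ≤ s) :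
    a + s ∈ wedge c := by
  intro t ht
  have h1 := ha (s + t) (by positivity)
  have h2 : ‖a + s‖ ≤ ‖a‖ + s := by
    refine (norm_add_le _ _).trans ?_
    simp [abs_of_nonneg hs]
  rw [Complex.ofReal_add, ← add_assoc, ← add_assoc] at h1
  refine le_trans ?_ h1
  exact mul_le_mul_of_nonneg_left (by linarith) hc

theorem add_ofReal_mem_slitPlane {a : ℂ} (ha : a ∈ Complex.slitPlane) {t : ℝ} (ht : 0 ≤ t) :
    a + t ∈ Complex.slitPlane := by
  rw [Complex.mem_slitPlane_iff] at ha ⊢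
  simp only [Complex.add_re, Complex.ofReal_re, Complex.add_im, Complex.ofReal_im, add_zero]
  rcases ha with h | h
  · left; linarith
  · right; exact h

theorem add_natCast_mem_slitPlane {a : ℂ} (ha : a ∈ Complex.slitPlane) (k : ℕ) :
    a + k ∈ Complex.slitPlane := by
  exact_mod_cast add_ofReal_mem_slitPlane ha (Nat.cast_nonneg (α := ℝ) k)

theorem mem_slitPlane_of_mem_wedge {c : ℝ} (hc : 0 < c) {a : ℂ} (ha : a ∈ wedge c) (h0 : a ≠ 0) :
    a ∈ Complex.slitPlane := by
  rw [Complex.mem_slitPlane_iff]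
  by_contra! h
  have h1 := ha (-a.re) (by linarith [h.1])
  have h2 : a + ((-a.re : ℝ) : ℂ) = 0 := by
    apply Complex.ext <;> simp [h.2]
  rw [h2, norm_zero] at h1
  have : 0 < ‖a‖ := norm_pos_iff.2 h0
  nlinarith [h.1, mul_pos hc this, mul_nonneg hc.le (neg_nonneg.2 h.1)]

/-- With `κ = |cos δ| < 1` one has `|z + t|² ≥ |z|² - 2κ|z|t + t²`, and this exceeds `(1 - κ)/2 ·
(|z| + t)²` by `(1 + κ)/2 · (|z| - t)²`. -/
theorem sector_subset_wedge {δ : ℝ} (h0 : 0 < δ) (hpi : δ < Real.pi) :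
    ∃ c : ℝ, 0 < c ∧ {z : ℂ | |z.arg| < Real.pi - δ} ⊆ wedge c := by
  have hcos : |Real.cos δ| < 1 := by
    rw [abs_lt]
    constructor
    · rw [← Real.cos_pi]
      exact Real.cos_lt_cos_of_nonneg_of_le_pi h0.le le_rfl hpi
    · rw [← Real.cos_zero]
      exact Real.cos_lt_cos_of_nonneg_of_le_pi le_rfl hpi.le h0
  set κ := |Real.cos δ| with hκ
  refine ⟨Real.sqrt ((1 - κ) / 2), Real.sqrt_pos.2 (by linarith), ?_⟩
  intro z hz t ht
  have hre : -κ * ‖z‖ ≤ z.re := by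
    have h1 : -Real.cos δ ≤ Real.cos z.arg := by
      rw [← Real.cos_pi_sub, ← Real.cos_abs z.arg]
      exact Real.cos_le_cos_of_nonneg_of_le_pi (abs_nonneg _) (by linarith) (le_of_lt hz)
    have h2 : z.re = ‖z‖ * Real.cos z.arg := (Complex.norm_mul_cos_arg z).symm
    have h3 : -κ ≤ Real.cos z.arg := by linarith [le_abs_self (Real.cos δ)]
    rw [h2]
    nlinarith [norm_nonneg z]
  have hsq : ‖z + t‖ ^ 2 = ‖z‖ ^ 2 + 2 * t * z.re + t ^ 2 := by
    rw [Complex.sq_norm, Complex.sq_norm, Complex.normSq_apply, Complex.normSq_apply]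
    simp
    ring
  refine abs_le_of_sq_le_sq' ?_ (norm_nonneg _) |>.2
  rw [mul_pow, Real.sq_sqrt (by linarith), hsq]
  have h4 : -(κ * ‖z‖) * t ≤ z.re * t := by nlinarith
  have h5 := mul_nonneg (add_nonneg zero_le_one (abs_nonneg (Real.cos δ))) (sq_nonneg (‖z‖ - t))
  rw [← hκ] at h5
  nlinarith

/-- Locally, the slit plane is contained in a wedge. -/
theorem exists_nhds_subset_wedge {a : ℂ} (ha : a ∈ Complex.slitPlane) :
    ∃ c ε : ℝ, 0 < c ∧ 0 < ε ∧ ∃ U : Set ℂ, IsOpen U ∧ a ∈ U ∧ U ⊆ Complex.slitPlane ∧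
      ∀ z ∈ U, z ∈ wedge c ∧ ε ≤ ‖z‖ := by
  have harg : |a.arg| < Real.pi :=
    abs_lt.2 ⟨Complex.neg_pi_lt_arg a, lt_of_le_of_ne (Complex.arg_le_pi a)
      (Complex.mem_slitPlane_iff_arg.1 ha).1⟩
  set δ := (Real.pi - |a.arg|) / 2 with hδ
  have hδ0 : 0 < δ := by linarith
  have hδ1 : δ < Real.pi := by linarith [abs_nonneg a.arg, Real.pi_pos]
  obtain ⟨c, hc, hsub⟩ := sector_subset_wedge hδ0 hδ1
  have hn : 0 < ‖a‖ := norm_pos_iff.2 (Complex.slitPlane_ne_zero ha)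
  have hev : ∀ᶠ z in nhds a, z ∈ Complex.slitPlane ∧ |z.arg| < Real.pi - δ ∧ ‖a‖ / 2 < ‖z‖ := by
    refine Filter.Eventually.and (Complex.isOpen_slitPlane.mem_nhds ha)
      (Filter.Eventually.and ?_ ?_)
    · exact ((Complex.continuousAt_arg ha).abs.eventually_lt continuousAt_const (by linarith))
    · exact continuousAt_const.eventually_lt continuousAt_id.norm (by simpa using hn)
  obtain ⟨U, hU, hUo, haU⟩ := eventually_nhds_iff.1 hev
  exact ⟨c, ‖a‖ / 2, hc, by positivity, U, hUo, haU, fun z hz => (hU z hz).1, fun z hz =>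
    ⟨hsub (hU z hz).2.1, (hU z hz).2.2.le⟩⟩

/-! ### The remainder in the Euler-Maclaurin formula for `∑ (a + k) ^ j log (a + k)` -/

theorem norm_bernoulliDefect_logTower_le {N j : ℕ} (hN : j + 1 ≤ N) {c : ℝ} (hc : 0 < c) {a : ℂ}
    (ha : a ∈ wedge c) (h0 : a ≠ 0) (k : ℕ) :
    ‖bernoulliDefect N (logTower j) (a + k)‖ ≤
      bernoulliConst N * (‖logTowerBeta j (N + 2)‖ * ((c * (‖a‖ + k)) ^ (N + 1 - j))⁻¹) := by
  have hs := mem_slitPlane_of_mem_wedge hc ha h0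
  have hn : 0 < ‖a‖ := norm_pos_iff.2 h0
  refine norm_bernoulliDefect_le N (isDerivTower_logTower j) (fun t ht => ?_) fun t ht => ?_
  · exact add_ofReal_mem_slitPlane (add_natCast_mem_slitPlane hs k) ht.1
  · rw [logTower_of_le (by omega), norm_mul, norm_inv, norm_pow,
      show N + 2 - j - 1 = N + 1 - j by omega]
    have h1 : c * (‖a‖ + k) ≤ ‖a + k + t‖ := by
      have := ha (k + t) (add_nonneg (Nat.cast_nonneg k) ht.1)
      rw [Complex.ofReal_add, Complex.ofReal_natCast, ← add_assoc, ← add_assoc] at this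
      refine le_trans ?_ this
      exact mul_le_mul_of_nonneg_left (by linarith [ht.1]) hc.le
    have h2 : 0 < c * (‖a‖ + k) := by positivity
    gcongr

theorem summable_inv_sq_add {ε : ℝ} (hε : 0 < ε) : Summable fun k : ℕ => ((ε + k) ^ 2)⁻¹ := by
  have h := (Real.summable_one_div_nat_add_rpow ε 2).2 (by norm_num)
  refine h.congr fun k => ?_
  rw [abs_of_nonneg (by positivity), Real.rpow_two, one_div, add_comm]

/-- Splits the exponent: two powers make the series in `k` converge, and the other `p - 2` are kept
as decay in `x`. -/
theorem inv_pow_le_inv_mul_inv_sq {p : ℕ} (hp : 2 ≤ p) {c x ε : ℝ} (hc : 0 < c) (hε : 0 < ε)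
    (hx : ε ≤ x) (k : ℕ) :
    ((c * (x + k)) ^ p)⁻¹ ≤ (c ^ p)⁻¹ * (x ^ (p - 2))⁻¹ * ((ε + k) ^ 2)⁻¹ := by
  have hx0 : 0 < x := hε.trans_le hx
  rw [← mul_inv, ← mul_inv]
  refine inv_anti₀ (by positivity) ?_
  rw [mul_pow, mul_assoc]
  refine mul_le_mul_of_nonneg_left ?_ (by positivity)
  calc x ^ (p - 2) * (ε + k) ^ 2 ≤ (x + k) ^ (p - 2) * (x + k) ^ 2 := by
        gcongr
        simp
    _ = (x + k) ^ p := by rw [← pow_add]; congr 1; omega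

/-- The remainder in the Euler-Maclaurin formula for `∑ (a + k) ^ j log (a + k)`. -/
noncomputable def logRemainder (N j : ℕ) (a : ℂ) : ℂ :=
  ∑' k : ℕ, bernoulliDefect N (logTower j) (a + k)

theorem norm_bernoulliDefect_logTower_le' {N j : ℕ} (hN : j + 1 ≤ N) {c ε : ℝ} (hc : 0 < c)
    (hε : 0 < ε) {a : ℂ} (ha : a ∈ wedge c) (h0 : ε ≤ ‖a‖) (k : ℕ) :
    ‖bernoulliDefect N (logTower j) (a + k)‖ ≤ bernoulliConst N * ‖logTowerBeta j (N + 2)‖ *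
      (c ^ (N + 1 - j))⁻¹ * (‖a‖ ^ (N - 1 - j))⁻¹ * ((ε + k) ^ 2)⁻¹ := by
  have h1 := norm_bernoulliDefect_logTower_le hN hc ha (norm_pos_iff.1 (hε.trans_le h0)) k
  have h2 := inv_pow_le_inv_mul_inv_sq (p := N + 1 - j) (by omega) hc hε h0 k
  rw [show N + 1 - j - 2 = N - 1 - j by omega] at h2
  refine h1.trans ?_
  rw [mul_assoc, mul_assoc, mul_assoc]
  refine mul_le_mul_of_nonneg_left (mul_le_mul_of_nonneg_left ?_ (norm_nonneg _))
    (bernoulliConst_nonneg N)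
  rw [← mul_assoc]
  exact h2

theorem summable_logRemainder {N j : ℕ} (hN : j + 1 ≤ N) {a : ℂ} (ha : a ∈ Complex.slitPlane) :
    Summable fun k : ℕ => bernoulliDefect N (logTower j) (a + k) := by
  obtain ⟨c, ε, hc, hε, U, -, haU, -, hw⟩ := exists_nhds_subset_wedge ha
  exact Summable.of_norm_bounded ((summable_inv_sq_add hε).mul_left _)
    (norm_bernoulliDefect_logTower_le' hN hc hε (hw a haU).1 (hw a haU).2)

/-- The exponent is one less than the sum over `k` would really give. The loss is harmless, since
`N` can be taken as large as desired. -/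
theorem norm_logRemainder_le {N j : ℕ} (hN : j + 1 ≤ N) {c : ℝ} (hc : 0 < c) :
    ∃ K : ℝ, ∀ a ∈ wedge c, 1 ≤ ‖a‖ → ‖logRemainder N j a‖ ≤ K * (‖a‖ ^ (N - 1 - j))⁻¹ := by
  refine ⟨bernoulliConst N * ‖logTowerBeta j (N + 2)‖ * (c ^ (N + 1 - j))⁻¹ *
    ∑' k : ℕ, ((1 + (k : ℝ)) ^ 2)⁻¹, fun a ha h1 => ?_⟩
  have hs := (summable_inv_sq_add one_pos).mul_left (bernoulliConst N * ‖logTowerBeta j (N + 2)‖ *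
      (c ^ (N + 1 - j))⁻¹ * (‖a‖ ^ (N - 1 - j))⁻¹)
  have := tsum_of_norm_bounded hs.hasSum
    (norm_bernoulliDefect_logTower_le' hN hc one_pos ha h1)
  rw [tsum_mul_left] at this
  refine this.trans (le_of_eq ?_)
  ring

theorem differentiableOn_bernoulliSum {f : ℕ → ℂ → ℂ} {s : Set ℂ} (hf : IsDerivTower s f) (N : ℕ) :
    DifferentiableOn ℂ (bernoulliSum N f) s := by
  intro x hx
  refine DifferentiableAt.differentiableWithinAt ?_
  exact DifferentiableAt.fun_sum fun r _ => (hf r x hx).differentiableAt.const_mul _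

theorem differentiableOn_logRemainder {N j : ℕ} (hN : j + 1 ≤ N) :
    DifferentiableOn ℂ (logRemainder N j) Complex.slitPlane := by
  intro a ha
  obtain ⟨c, ε, hc, hε, U, hUo, haU, hUs, hw⟩ := exists_nhds_subset_wedge ha
  refine DifferentiableAt.differentiableWithinAt ?_
  refine (Complex.differentiableOn_tsum_of_summable_norm (u := fun k : ℕ =>
    bernoulliConst N * ‖logTowerBeta j (N + 2)‖ * (c ^ (N + 1 - j))⁻¹ * (ε ^ (N - 1 - j))⁻¹ *
      ((ε + k) ^ 2)⁻¹) ((summable_inv_sq_add hε).mul_left _) ?_ hUo ?_).differentiableAt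
    (hUo.mem_nhds haU)
  · intro k z hz
    have hd := differentiableOn_bernoulliSum (isDerivTower_logTower j) N
    have hz0 := add_natCast_mem_slitPlane (hUs hz) k
    have hz1 : z + k + 1 ∈ Complex.slitPlane := by
      have := add_natCast_mem_slitPlane (hUs hz) (k + 1)
      rwa [Nat.cast_add, Nat.cast_one, ← add_assoc] at this
    have hn : ∀ w ∈ Complex.slitPlane, DifferentiableAt ℂ (bernoulliSum N (logTower j)) w :=
      fun w hw => (hd w hw).differentiableAt (Complex.isOpen_slitPlane.mem_nhds hw)
    refine DifferentiableAt.differentiableWithinAt ?_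
    have e1 := DifferentiableAt.comp z (hn _ hz1)
      ((differentiableAt_id.add_const (k : ℂ)).add_const 1)
    have e2 := DifferentiableAt.comp z (hn _ hz0) (differentiableAt_id.add_const (k : ℂ))
    have e3 := DifferentiableAt.comp z (isDerivTower_logTower j 1 _ hz0).differentiableAt
      (differentiableAt_id.add_const (k : ℂ))
    exact (e1.sub e2).sub e3
  · intro k z hz
    refine (norm_bernoulliDefect_logTower_le' hN hc hε (hw z hz).1 (hw z hz).2 k).trans ?_
    have := bernoulliConst_nonneg N
    have := (hw z hz).2
    gcongr

/-! ### The derivative of the Hurwitz zeta function at `-j` -/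

/-- The derivative with respect to `s`, at `s = -j`, of the Hurwitz zeta function `ζ(s, a)`. -/
noncomputable def hurwitzLog (j : ℕ) (a : ℂ) : ℂ :=
  bernoulliSum (j + 1) (logTower j) a + logRemainder (j + 1) j a

theorem sum_range_bernoulliDefect (N : ℕ) (f : ℕ → ℂ → ℂ) (a : ℂ) (K : ℕ) :
    ∑ k ∈ Finset.range K, bernoulliDefect N f (a + k) =
      bernoulliSum N f (a + K) - bernoulliSum N f a - ∑ k ∈ Finset.range K, f 1 (a + k) := by
  induction K with
  | zero => simp
  | succ K ih =>
    rw [Finset.sum_range_succ, Finset.sum_range_succ, ih, bernoulliDefect]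
    push_cast
    rw [← add_assoc]
    ring

theorem tendsto_logTower {j r : ℕ} (h : j + 2 ≤ r) :
    Tendsto (logTower j r) (Bornology.cobounded ℂ) (nhds 0) := by
  have e : logTower j r = fun a => logTowerBeta j r * (a⁻¹) ^ (r - j - 1) := by
    funext a; rw [logTower_of_le h, inv_pow]
  rw [e]
  have h1 := (tendsto_inv₀_cobounded (α := ℂ)).pow (r - j - 1)
  rw [zero_pow (by omega)] at h1
  simpa using h1.const_mul (logTowerBeta j r)

theorem tendsto_add_natCast_cobounded (a : ℂ) :
    Tendsto (fun k : ℕ => a + k) atTop (Bornology.cobounded ℂ) := by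
  refine tendsto_norm_atTop_iff_cobounded.1 ?_
  refine tendsto_atTop_mono (f := fun k : ℕ => (k : ℝ) - ‖a‖) (fun k => ?_)
    (tendsto_atTop_add_const_right _ _ tendsto_natCast_atTop_atTop)
  have := norm_sub_norm_le (k : ℂ) (-a)
  rw [norm_neg, sub_neg_eq_add, Complex.norm_natCast, add_comm] at this
  exact this

/-- The right-hand side is the limit of `bernoulliSum N (logTower j) (a + K) - ∑_{k<K} (a + k)^j log
(a + k)` as `K → ∞`. Raising `N` by one adds a multiple of `logTower j (N + 1) (a + K)`, which tends
to `0` because `N + 1 ≥ j + 2`. -/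
theorem hurwitzLog_eq {N j : ℕ} (hN : j + 1 ≤ N) {a : ℂ} (ha : a ∈ Complex.slitPlane) :
    hurwitzLog j a = bernoulliSum N (logTower j) a + logRemainder N j a := by
  have key : ∀ N, j + 1 ≤ N → Tendsto (fun K : ℕ => bernoulliSum N (logTower j) (a + K) -
      ∑ k ∈ Finset.range K, logTower j 1 (a + k)) atTop
      (nhds (bernoulliSum N (logTower j) a + logRemainder N j a)) := by
    intro N hN
    have := (summable_logRemainder hN ha).hasSum.tendsto_sum_nat
    refine (this.const_add (bernoulliSum N (logTower j) a)).congr fun K => ?_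
    rw [sum_range_bernoulliDefect]
    ring
  induction N, hN using Nat.le_induction with
  | base => rfl
  | succ N hN ih =>
    rw [ih]
    refine tendsto_nhds_unique (key N hN) ?_
    have h1 := (key (N + 1) (by omega)).sub
      (((tendsto_logTower (show j + 2 ≤ N + 1 by omega)).comp
        (tendsto_add_natCast_cobounded a)).const_mul
          ((_root_.bernoulli (N + 1) : ℂ) / ((N + 1).factorial : ℂ)))
    rw [mul_zero, sub_zero] at h1
    refine h1.congr fun K => ?_
    simp only [bernoulliSum, Function.comp_apply]
    rw [Finset.sum_range_succ _ (N + 1)]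
    ring

theorem hurwitzLog_add_one (j : ℕ) {a : ℂ} (ha : a ∈ Complex.slitPlane) :
    hurwitzLog j (a + 1) = hurwitzLog j a + a ^ j * Complex.log a := by
  have h1 := (summable_logRemainder (le_refl (j + 1)) ha).tsum_eq_zero_add
  have e : ∀ k : ℕ, a + ((k + 1 : ℕ) : ℂ) = a + 1 + k := fun k => by push_cast; ring
  simp only [e, Nat.cast_zero, add_zero] at h1
  rw [hurwitzLog, hurwitzLog, logRemainder, logRemainder, h1, bernoulliDefect, logTower_one]
  ring

theorem differentiableOn_hurwitzLog (j : ℕ) :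
    DifferentiableOn ℂ (hurwitzLog j) Complex.slitPlane :=
  (differentiableOn_bernoulliSum (isDerivTower_logTower j) _).add
    (differentiableOn_logRemainder le_rfl)

/-! ### The Euler-Maclaurin formula for the Riemann zeta function -/

/-- The coefficients in `powTower`. -/
noncomputable def powCoeff : ℕ → ℂ → ℂ
  | 0, s => 1 / (1 - s)
  | r + 1, s => (1 - s - r) * powCoeff r s

/-- The derivatives of the primitive `a ^ (1 - s) / (1 - s)` of `a ^ (-s)`. -/
noncomputable def powTower (s : ℂ) (r : ℕ) (a : ℂ) : ℂ := powCoeff r s * a ^ (1 - s - r)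

theorem isDerivTower_powTower (s : ℂ) : IsDerivTower Complex.slitPlane (powTower s) := by
  intro r a ha
  have h := ((Complex.hasStrictDerivAt_cpow_const (c := 1 - s - r) ha).hasDerivAt).const_mul
    (powCoeff r s)
  refine h.congr_deriv ?_
  rw [powTower, powCoeff]
  push_cast
  rw [← sub_sub]
  ring

theorem powTower_one {s : ℂ} (hs : s ≠ 1) (a : ℂ) : powTower s 1 a = a ^ (-s) := by
  have : 1 - s ≠ 0 := sub_ne_zero.2 (Ne.symm hs)
  rw [powTower, powCoeff, powCoeff]
  push_cast
  rw [sub_zero, mul_one_div_cancel this, one_mul]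
  congr 1
  ring

theorem powCoeff_neg_natCast (j r : ℕ) : powCoeff r (-(j : ℂ)) = logTowerAlpha j r := by
  induction r with
  | zero => simp [powCoeff, logTowerAlpha, add_comm]
  | succ r ih => rw [powCoeff, logTowerAlpha, ih]; ring

theorem hasDerivAt_powCoeff (j r : ℕ) :
    HasDerivAt (powCoeff r) (-logTowerBeta j r) (-(j : ℂ)) := by
  induction r with
  | zero =>
    have h0 : (1 : ℂ) - -(j : ℂ) ≠ 0 := by
      rw [sub_neg_eq_add, add_comm]; exact_mod_cast j.succ_ne_zero
    have h := (((hasDerivAt_id (-(j : ℂ))).const_sub 1).fun_inv h0)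
    have e : powCoeff 0 = fun s : ℂ => (1 - id s)⁻¹ := by funext s; simp [powCoeff]
    rw [e]
    refine h.congr_deriv ?_
    simp [logTowerBeta, add_comm]
  | succ r ih =>
    have h := (((hasDerivAt_id (-(j : ℂ))).const_sub 1).sub_const (r : ℂ)).mul ih
    refine h.congr_deriv ?_
    rw [powCoeff_neg_natCast, logTowerBeta]
    simp only [id_eq]
    ring

/-- The constants in `logTower` are those that make it minus the `s`-derivative of `powTower` at `s
= -j` on every level. Hence Euler-Maclaurin for `ζ(s)` differentiates term by term into the
expansion defining `hurwitzLog j 1`. -/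
theorem hasDerivAt_powTower (j r : ℕ) {x : ℂ} (hx : x ≠ 0) :
    HasDerivAt (fun s => powTower s r x) (-logTower j r x) (-(j : ℂ)) := by
  have h1 : HasDerivAt (fun s : ℂ => 1 - s - r) (-1) (-(j : ℂ)) :=
    ((hasDerivAt_id (-(j : ℂ))).const_sub 1).sub_const (r : ℂ)
  have h := (hasDerivAt_powCoeff j r).mul (h1.const_cpow (c := x) (Or.inl hx))
  refine h.congr_deriv ?_
  have e : x ^ (1 - -(j : ℂ) - r) = x ^ ((j : ℤ) + 1 - r) := by
    rw [← Complex.cpow_intCast]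
    congr 1
    push_cast
    ring
  rw [e, powCoeff_neg_natCast, logTower]
  ring

theorem hasDerivAt_bernoulliDefect_powTower (N j : ℕ) {x : ℂ} (hx : x ≠ 0) (hx1 : x + 1 ≠ 0) :
    HasDerivAt (fun s => bernoulliDefect N (powTower s) x) (-bernoulliDefect N (logTower j) x)
      (-(j : ℂ)) := by
  have hs : ∀ y : ℂ, y ≠ 0 → HasDerivAt (fun s => bernoulliSum N (powTower s) y)
      (-bernoulliSum N (logTower j) y) (-(j : ℂ)) := by
    intro y hy
    have := HasDerivAt.fun_sum (u := Finset.range (N + 1)) fun r _ =>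
      ((hasDerivAt_powTower j r hy).const_mul
        ((_root_.bernoulli r : ℂ) / (r.factorial : ℂ)))
    refine this.congr_deriv ?_
    rw [bernoulliSum, ← Finset.sum_neg_distrib]
    exact Finset.sum_congr rfl fun _ _ => by ring
  refine (((hs _ hx1).sub (hs _ hx)).sub (hasDerivAt_powTower j 1 hx)).congr_deriv ?_
  rw [bernoulliDefect]
  ring

theorem differentiableAt_powTower (r : ℕ) {x s : ℂ} (hx : x ≠ 0) (hs : s ≠ 1) :
    DifferentiableAt ℂ (fun s => powTower s r x) s := by
  have h : DifferentiableAt ℂ (powCoeff r) s := by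
    induction r with
    | zero =>
      have : powCoeff 0 = fun s : ℂ => (1 : ℂ) / (1 - s) := rfl
      rw [this]
      have : (1 : ℂ) - s ≠ 0 := sub_ne_zero.2 (Ne.symm hs)
      fun_prop (disch := assumption)
    | succ r ih =>
      have : powCoeff (r + 1) = fun s : ℂ => (1 - s - r) * powCoeff r s := rfl
      rw [this]
      fun_prop
  have h2 : DifferentiableAt ℂ (fun s : ℂ => x ^ (1 - s - r)) s :=
    DifferentiableAt.const_cpow (by fun_prop) (Or.inl hx)
  exact h.mul h2

theorem differentiableAt_bernoulliSum_powTower (N : ℕ) {x s : ℂ} (hx : x ≠ 0) (hs : s ≠ 1) :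
    DifferentiableAt ℂ (fun s => bernoulliSum N (powTower s) x) s :=
  DifferentiableAt.fun_sum fun r _ => (differentiableAt_powTower r hx hs).const_mul _

/-- From level `1` on, the factor `1 - s` has cancelled the pole of `1 / (1 - s)`, and the
coefficient is a polynomial in `s`. -/
theorem exists_norm_powCoeff_le (R : ℝ) (r : ℕ) :
    ∃ Q : ℝ, 0 ≤ Q ∧ ∀ s : ℂ, s ≠ 1 → ‖s‖ < R → ‖powCoeff (r + 1) s‖ ≤ Q := by
  induction r with
  | zero =>
    refine ⟨1, zero_le_one, fun s hs _ => ?_⟩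
    have : 1 - s ≠ 0 := sub_ne_zero.2 (Ne.symm hs)
    rw [powCoeff, powCoeff]
    simp [this]
  | succ r ih =>
    obtain ⟨Q, hQ0, hQ⟩ := ih
    refine ⟨|1 + R + (r + 1)| * Q, by positivity, fun s hs hR => ?_⟩
    rw [powCoeff, norm_mul]
    refine mul_le_mul ?_ (hQ s hs hR) (norm_nonneg _) (abs_nonneg _)
    have h1 := norm_sub_le (1 - s) ((r + 1 : ℕ) : ℂ)
    have h2 := norm_sub_le 1 s
    rw [Complex.norm_natCast] at h1
    rw [norm_one] at h2
    push_cast at h1 ⊢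
    refine le_trans ?_ (le_abs_self _)
    linarith

theorem norm_powTower_ofReal (s : ℂ) (r : ℕ) {x : ℝ} (hx : 0 < x) :
    ‖powTower s r x‖ = ‖powCoeff r s‖ * x ^ (1 - s.re - r) := by
  rw [powTower, norm_mul, Complex.norm_cpow_eq_rpow_re_of_pos hx]
  simp

/-- A convex neighbourhood of `-j` which avoids the pole of `ζ` and meets the half-plane of
absolute convergence. -/
def zetaRegion (j : ℕ) : Set ℂ := {s | s.re - 1 < s.im ∧ -(j : ℝ) - 1 < s.re ∧ ‖s‖ < j + 4}

theorem isOpen_zetaRegion (j : ℕ) : IsOpen (zetaRegion j) := by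
  have h1 : IsOpen {s : ℂ | s.re - 1 < s.im} :=
    isOpen_lt (Complex.continuous_re.sub continuous_const) Complex.continuous_im
  have h2 : IsOpen {s : ℂ | -(j : ℝ) - 1 < s.re} := isOpen_lt continuous_const Complex.continuous_re
  have h3 : IsOpen {s : ℂ | ‖s‖ < j + 4} := isOpen_lt continuous_norm continuous_const
  exact h1.inter (h2.inter h3)

theorem isPreconnected_zetaRegion (j : ℕ) : IsPreconnected (zetaRegion j) := by
  refine Convex.isPreconnected ?_
  have h1 : Convex ℝ {s : ℂ | s.re - 1 < s.im} := by
    intro x hx y hy a b ha hb hab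
    simp only [Set.mem_ofPred_eq, Complex.add_re, Complex.add_im, Complex.real_smul, Complex.re_ofReal_mul,
      Complex.im_ofReal_mul] at *
    rcases ha.eq_or_lt with h | h
    · have : b = 1 := by linarith
      subst this; subst h; linarith
    · nlinarith
  have h2 : Convex ℝ {s : ℂ | -(j : ℝ) - 1 < s.re} := convex_halfSpace_re_gt _
  have h3 : Convex ℝ {s : ℂ | ‖s‖ < j + 4} := by
    have := convex_ball (0 : ℂ) ((j : ℝ) + 4)
    have e : {s : ℂ | ‖s‖ < j + 4} = Metric.ball 0 ((j : ℝ) + 4) := by ext s; simp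
    rw [e]
    exact this
  exact h1.inter (h2.inter h3)

theorem ne_one_of_mem_zetaRegion {j : ℕ} {s : ℂ} (hs : s ∈ zetaRegion j) : s ≠ 1 := by
  rintro rfl
  have := hs.1
  simp at this

/-- The truncation order `j + 2` brings in the derivative of index `j + 4`, whose exponent has real
part `1 - Re s - (j + 4) < -2` because `Re s > -j - 1`. The majorant is uniform on the region, as
termwise differentiation in `s` requires. -/
theorem exists_norm_bernoulliDefect_powTower_le (j : ℕ) : ∃ Q : ℝ, ∀ k : ℕ, ∀ s ∈ zetaRegion j,
    ‖bernoulliDefect (j + 2) (powTower s) (1 + k)‖ ≤ Q * ((1 + (k : ℝ)) ^ 2)⁻¹ := by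
  obtain ⟨Q, hQ0, hQ⟩ := exists_norm_powCoeff_le (j + 4) (j + 3)
  refine ⟨bernoulliConst (j + 2) * Q, fun k s hs => ?_⟩
  rw [mul_assoc]
  have e : ∀ t : ℝ, (1 : ℂ) + k + t = ((1 + k + t : ℝ) : ℂ) := fun t => by push_cast; rfl
  refine norm_bernoulliDefect_le (j + 2) (isDerivTower_powTower s) (fun t ht => ?_) fun t ht => ?_
  · rw [e, Complex.ofReal_mem_slitPlane]
    have := ht.1
    positivity
  · have ht0 := ht.1
    rw [e, norm_powTower_ofReal _ _ (by positivity)]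
    refine mul_le_mul (hQ s (ne_one_of_mem_zetaRegion hs) hs.2.2) ?_ (by positivity) hQ0
    rw [← Real.rpow_two, ← Real.rpow_neg (by positivity)]
    calc (1 + (k : ℝ) + t) ^ (1 - s.re - ((j + 2 + 2 : ℕ) : ℝ))
        ≤ (1 + (k : ℝ) + t) ^ (-2 : ℝ) := by
          refine Real.rpow_le_rpow_of_exponent_le ?_ ?_
          · have : (0 : ℝ) ≤ k := Nat.cast_nonneg k
            linarith
          · push_cast
            linarith [hs.2.1]
      _ ≤ (1 + (k : ℝ)) ^ (-2 : ℝ) :=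
          Real.rpow_le_rpow_of_nonpos (by positivity) (by linarith) (by norm_num)

theorem tendsto_bernoulliSum_powTower {s : ℂ} (hs : 1 < s.re) (N : ℕ) :
    Tendsto (fun K : ℕ => bernoulliSum N (powTower s) (1 + K)) atTop (nhds 0) := by
  have h : ∀ r : ℕ, Tendsto (fun K : ℕ => powTower s r (1 + K)) atTop (nhds 0) := by
    intro r
    rw [tendsto_zero_iff_norm_tendsto_zero]
    have e : ∀ K : ℕ, ‖powTower s r (1 + K)‖ = ‖powCoeff r s‖ * (1 + (K : ℝ)) ^ (-(s.re + r - 1)) := by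
      intro K
      have := norm_powTower_ofReal s r (x := 1 + K) (by positivity)
      push_cast at this
      rw [this]
      congr 2
      ring
    simp only [e]
    have h1 : (0 : ℝ) < s.re + r - 1 := by
      have : (0 : ℝ) ≤ r := Nat.cast_nonneg r
      linarith
    have := ((tendsto_rpow_neg_atTop h1).comp
      (tendsto_atTop_add_const_left atTop (1 : ℝ) tendsto_natCast_atTop_atTop)).const_mul
        ‖powCoeff r s‖
    simpa using this
  have := tendsto_finsetSum (Finset.range (N + 1)) fun r _ =>
    (h r).const_mul ((_root_.bernoulli r : ℂ) / (r.factorial : ℂ))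
  simpa [bernoulliSum] using this

/-- Sum the one-step identities over `k < K` and let `K → ∞`; for `Re s > 1` the boundary
contribution at `1 + K` vanishes. -/
theorem riemannZeta_eq_of_one_lt_re {j : ℕ} {s : ℂ} (hs : s ∈ zetaRegion j) (h1 : 1 < s.re) :
    riemannZeta s = -bernoulliSum (j + 2) (powTower s) 1
      - ∑' k : ℕ, bernoulliDefect (j + 2) (powTower s) (1 + k) := by
  obtain ⟨Q, hQ⟩ := exists_norm_bernoulliDefect_powTower_le j
  have hsum : Summable fun k : ℕ => bernoulliDefect (j + 2) (powTower s) (1 + k) :=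
    Summable.of_norm_bounded ((summable_inv_sq_add one_pos).mul_left Q) fun k => hQ k s hs
  have hz : Summable fun n : ℕ => 1 / ((n : ℂ) + 1) ^ s := by
    have := (summable_nat_add_iff 1).2 (Complex.summable_one_div_nat_cpow.2 h1)
    simpa using this
  have l1 := hsum.hasSum.tendsto_sum_nat
  have l2 := ((tendsto_bernoulliSum_powTower h1 (j + 2)).sub_const
    (bernoulliSum (j + 2) (powTower s) 1)).sub hz.hasSum.tendsto_sum_nat
  have := tendsto_nhds_unique l1 (l2.congr fun K => by
    rw [sum_range_bernoulliDefect]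
    congr 1
    refine Finset.sum_congr rfl fun k _ => ?_
    rw [powTower_one (ne_one_of_mem_zetaRegion hs), Complex.cpow_neg, one_div, add_comm])
  rw [zeta_eq_tsum_one_div_nat_add_one_cpow h1, this]
  ring

theorem one_add_natCast_ne_zero (k : ℕ) : (1 : ℂ) + k ≠ 0 := by
  rw [add_comm]; exact_mod_cast k.succ_ne_zero

theorem one_add_natCast_add_one_ne_zero (k : ℕ) : (1 : ℂ) + k + 1 ≠ 0 := by
  have := one_add_natCast_ne_zero (k + 1)
  rwa [Nat.cast_add, Nat.cast_one, ← add_assoc] at this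

theorem differentiableOn_bernoulliDefect_powTower (N j k : ℕ) :
    DifferentiableOn ℂ (fun s => bernoulliDefect N (powTower s) (1 + k)) (zetaRegion j) := by
  intro s hs
  have h1 := ne_one_of_mem_zetaRegion hs
  exact (((differentiableAt_bernoulliSum_powTower N (one_add_natCast_add_one_ne_zero k) h1).sub
    (differentiableAt_bernoulliSum_powTower N (one_add_natCast_ne_zero k) h1)).sub
    (differentiableAt_powTower 1 (one_add_natCast_ne_zero k) h1)).differentiableWithinAt

theorem riemannZeta_eqOn (j : ℕ) : Set.EqOn riemannZeta
    (fun s => -bernoulliSum (j + 2) (powTower s) 1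
      - ∑' k : ℕ, bernoulliDefect (j + 2) (powTower s) (1 + k)) (zetaRegion j) := by
  obtain ⟨Q, hQ⟩ := exists_norm_bernoulliDefect_powTower_le j
  have ho := isOpen_zetaRegion j
  -- A base point for the identity theorem: it has `Re s > 1`, lies on the right side of the line
  -- `Im s = Re s - 1`, and has modulus `2√2 < 4`.
  have hmem : (2 + 2 * Complex.I : ℂ) ∈ zetaRegion j := by
    refine ⟨by norm_num, ?_, ?_⟩
    · have : (0 : ℝ) ≤ j := Nat.cast_nonneg j
      simp; linarith
    · have h : ‖(2 + 2 * Complex.I : ℂ)‖ < 4 := by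
        refine lt_of_pow_lt_pow_left₀ 2 (by norm_num) ?_
        rw [Complex.sq_norm, Complex.normSq_apply]
        norm_num
      have : (0 : ℝ) ≤ j := Nat.cast_nonneg j
      linarith
  refine AnalyticOnNhd.eqOn_of_preconnected_of_eventuallyEq
    (DifferentiableOn.analyticOnNhd ?_ ho) (DifferentiableOn.analyticOnNhd ?_ ho)
    (isPreconnected_zetaRegion j) hmem ?_
  · intro s hs
    exact (differentiableAt_riemannZeta (ne_one_of_mem_zetaRegion hs)).differentiableWithinAt
  · refine DifferentiableOn.sub (fun s hs => ?_) ?_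
    · exact (differentiableAt_bernoulliSum_powTower _ one_ne_zero
        (ne_one_of_mem_zetaRegion hs)).neg.differentiableWithinAt
    · exact Complex.differentiableOn_tsum_of_summable_norm
        ((summable_inv_sq_add one_pos).mul_left Q)
        (fun k => differentiableOn_bernoulliDefect_powTower _ _ k) ho hQ
  · filter_upwards [ho.mem_nhds hmem, (isOpen_lt continuous_const Complex.continuous_re).mem_nhds
      (show (1 : ℝ) < (2 + 2 * Complex.I : ℂ).re by norm_num)] with s hs h1
    exact riemannZeta_eq_of_one_lt_re hs h1

/-- Differentiate the representation of `ζ` in `riemannZeta_eqOn` at `s = -j`, term by term. It is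
truncated at order `j + 2`, which agrees with `hurwitzLog` by independence of the order. -/
theorem hurwitzLog_one (j : ℕ) : hurwitzLog j 1 = deriv riemannZeta (-(j : ℂ)) := by
  obtain ⟨Q, hQ⟩ := exists_norm_bernoulliDefect_powTower_le j
  have ho := isOpen_zetaRegion j
  have hmem : -(j : ℂ) ∈ zetaRegion j := by
    refine ⟨?_, by simp, by simp⟩
    have : (0 : ℝ) ≤ j := Nat.cast_nonneg j
    simp; linarith
  have hsum := Complex.hasSum_deriv_of_summable_norm ((summable_inv_sq_add one_pos).mul_left Q)
    (fun k => differentiableOn_bernoulliDefect_powTower (j + 2) j k) ho hQ hmem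
  have hd : DifferentiableAt ℂ (fun s => ∑' k : ℕ, bernoulliDefect (j + 2) (powTower s) (1 + k))
      (-(j : ℂ)) := (Complex.differentiableOn_tsum_of_summable_norm
        ((summable_inv_sq_add one_pos).mul_left Q)
        (fun k => differentiableOn_bernoulliDefect_powTower _ _ k) ho hQ).differentiableAt
          (ho.mem_nhds hmem)
  have hb : HasDerivAt (fun s => bernoulliSum (j + 2) (powTower s) 1)
      (-bernoulliSum (j + 2) (logTower j) 1) (-(j : ℂ)) := by
    have := HasDerivAt.fun_sum (u := Finset.range (j + 2 + 1)) fun r _ =>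
      ((hasDerivAt_powTower j r one_ne_zero).const_mul
        ((_root_.bernoulli r : ℂ) / (r.factorial : ℂ)))
    refine this.congr_deriv ?_
    rw [bernoulliSum, ← Finset.sum_neg_distrib]
    exact Finset.sum_congr rfl fun _ _ => by ring
  have hev : riemannZeta =ᶠ[nhds (-(j : ℂ))] _ :=
    Filter.eventually_of_mem (ho.mem_nhds hmem) (riemannZeta_eqOn j)
  rw [hev.deriv_eq, (hb.fun_neg.fun_sub hd.hasDerivAt).deriv, ← hsum.tsum_eq,
    hurwitzLog_eq (N := j + 2) (by omega) Complex.one_mem_slitPlane, logRemainder, neg_neg,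
    sub_eq_add_neg, ← tsum_neg]
  congr 1
  refine tsum_congr fun k => ?_
  rw [(hasDerivAt_bernoulliDefect_powTower (j + 2) j (one_add_natCast_ne_zero k)
    (one_add_natCast_add_one_ne_zero k)).deriv, neg_neg]

/-! ### Binomial polynomials -/

theorem binomPoly_zero : binomPoly 0 = 1 := by simp [binomPoly]

theorem binomPoly_eval_zero {m : ℕ} (hm : m ≠ 0) : (binomPoly m).eval 0 = 0 := by
  simp [binomPoly, hm]

theorem binomPoly_eval_add_one (m : ℕ) (x : ℂ) :
    (binomPoly (m + 1)).eval (x + 1) = (binomPoly (m + 1)).eval x + (binomPoly m).eval x := by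
  have h1 : (descPochhammer ℂ (m + 1)).eval (x + 1) = (x + 1) * (descPochhammer ℂ m).eval x := by
    rw [descPochhammer_succ_left]
    simp
  have h2 : (descPochhammer ℂ (m + 1)).eval x = (descPochhammer ℂ m).eval x * (x - m) := by
    rw [descPochhammer_succ_right]
    simp
  simp only [binomPoly, eval_mul, eval_C, h1, h2]
  have a1 : (m.factorial : ℂ) ≠ 0 := by exact_mod_cast m.factorial_ne_zero
  have a2 : (m : ℂ) + 1 ≠ 0 := by exact_mod_cast m.succ_ne_zero
  rw [Nat.factorial_succ]
  push_cast
  field_simp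
  ring

theorem natDegree_binomPoly_le (m : ℕ) : (binomPoly m).natDegree ≤ m := by
  refine (natDegree_C_mul_le _ _).trans ?_
  rw [descPochhammer_natDegree]

theorem isDerivTower_polynomial (p : ℂ[X]) :
    IsDerivTower Set.univ (fun i x => (derivative^[i] p).eval x) := by
  intro i x _
  change HasDerivAt (fun x => (derivative^[i] p).eval x) ((derivative^[i + 1] p).eval x) x
  rw [Function.iterate_succ_apply']
  exact (derivative^[i] p).hasDerivAt x

theorem iteratedDeriv_polynomial (p : ℂ[X]) (k : ℕ) (z : ℂ) :
    iteratedDeriv k (fun w => p.eval w) z = (derivative^[k] p).eval z :=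
  (isDerivTower_polynomial p).iteratedDeriv_eq isOpen_univ k (Set.mem_univ z)

theorem iterate_derivative_comp_C_sub_X (p : ℂ[X]) (c : ℂ) (k : ℕ) :
    derivative^[k] (p.comp (C c - X)) = C ((-1) ^ k) * (derivative^[k] p).comp (C c - X) := by
  induction k with
  | zero => simp
  | succ k ih =>
    rw [Function.iterate_succ_apply', ih, Function.iterate_succ_apply']
    simp only [derivative_mul, derivative_C, derivative_comp, derivative_sub, derivative_X, zero_mul,
      zero_add, zero_sub, pow_succ, C_mul, C_neg, C_1]
    ring

theorem binomDeriv_eq (n k : ℕ) (z : ℂ) :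
    binomDeriv n k z = (-1) ^ k * (derivative^[k] (binomPoly (n - 1))).eval z := by
  rw [binomDeriv, iteratedDeriv_polynomial]

theorem binomDeriv_zero (n : ℕ) (z : ℂ) : binomDeriv n 0 z = (binomPoly (n - 1)).eval z := by
  simp [binomDeriv_eq]

theorem binomDeriv_eq_zero {n k : ℕ} (h : n - 1 < k) (z : ℂ) : binomDeriv n k z = 0 := by
  rw [binomDeriv_eq, iterate_derivative_eq_zero ((natDegree_binomPoly_le _).trans_lt h)]
  simp

theorem isDerivTower_binomDeriv (n : ℕ) :
    IsDerivTower Set.univ (fun i t => binomDeriv n i (-t)) := by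
  intro i x hx
  have h := isDerivTower_polynomial ((binomPoly (n - 1)).comp (C 0 - X)) i x hx
  have e : ∀ i, (fun x => (derivative^[i] ((binomPoly (n - 1)).comp (C 0 - X))).eval x) =
      fun t => binomDeriv n i (-t) := by
    intro i
    funext t
    rw [iterate_derivative_comp_C_sub_X, binomDeriv_eq]
    simp
  change HasDerivAt (fun t => binomDeriv n i (-t)) ((fun t => binomDeriv n (i + 1) (-t)) x) x
  rw [← e, ← e]
  exact h

theorem binomCoeff_eq (n j : ℕ) (z : ℂ) : binomCoeff n j z = binomDeriv n j z / (j.factorial : ℂ) := by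
  have h := coeff_iterate_derivative (p := (binomPoly (n - 1)).comp (C z - X)) (k := j) 0
  rw [zero_add, Nat.descFactorial_self, iterate_derivative_comp_C_sub_X, coeff_zero_eq_eval_zero] at h
  have a1 : (j.factorial : ℂ) ≠ 0 := by exact_mod_cast j.factorial_ne_zero
  rw [binomCoeff, binomDeriv_eq, eq_div_iff a1, mul_comm, ← nsmul_eq_mul, ← h]
  simp

theorem binomCoeff_one_zero (z : ℂ) : binomCoeff 1 0 z = 1 := by
  simp [binomCoeff_eq, binomDeriv_zero, binomPoly_zero]

theorem binomCoeff_eq_zero {n j : ℕ} (h : n - 1 < j) (z : ℂ) : binomCoeff n j z = 0 := by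
  rw [binomCoeff_eq, binomDeriv_eq_zero h, zero_div]

theorem sum_binomCoeff_mul_pow {n : ℕ} (hn : 1 ≤ n) (z u : ℂ) :
    ∑ j ∈ Finset.range n, binomCoeff n j z * u ^ j = (binomPoly (n - 1)).eval (z - u) := by
  have hd : ((binomPoly (n - 1)).comp (C z - X)).natDegree < n := by
    refine lt_of_le_of_lt (natDegree_comp_le.trans (Nat.mul_le_mul (natDegree_binomPoly_le _)
      (natDegree_sub_le_of_le (natDegree_C z).le (natDegree_X_le)))) ?_
    simp
    omega
  have := eval_eq_sum_range' hd u
  rw [eval_comp] at this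
  simp only [eval_sub, eval_C, eval_X] at this
  exact this.symm

theorem binomCoeff_add_one (n j : ℕ) (z : ℂ) :
    binomCoeff (n + 2) j (z + 1) = binomCoeff (n + 2) j z + binomCoeff (n + 1) j z := by
  have h : (binomPoly (n + 1)).comp (C (z + 1) - X) =
      (binomPoly (n + 1)).comp (C z - X) + (binomPoly n).comp (C z - X) := by
    refine Polynomial.funext fun u => ?_
    have := binomPoly_eval_add_one n (z - u)
    simp only [eval_comp, eval_add, eval_sub, eval_C, eval_X]
    rw [← this]
    congr 1
    ring
  simp only [binomCoeff, Nat.add_sub_cancel, show n + 2 - 1 = n + 1 by omega]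
  rw [h, coeff_add]

/-! ### The logarithms of the multiple gamma functions -/

/-- The logarithm of `G_n(z + 1)`. -/
noncomputable def logMultGamma : ℕ → ℂ → ℂ
  | 0, z => Complex.log (z + 1)
  | n + 1, z => ∑ j ∈ Finset.range (n + 1),
      binomCoeff (n + 1) j z * (hurwitzLog j (z + 1) - hurwitzLog j 1)

theorem logMultGamma_zero_right (n : ℕ) : logMultGamma n 0 = 0 := by
  cases n <;> simp [logMultGamma]

/-- The shift of `hurwitzLog` contributes `∑_j G_{n+1,j}(z+1) (z+1)^j log(z+1) = binom(0, n)
log(z+1)`, which is `log(z+1)` for `n = 0` and zero otherwise. For `n ≥ 1` the shift of the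
coefficients gives level `n` by Pascal's rule. -/
theorem logMultGamma_add_one (n : ℕ) {z : ℂ} (hz : z + 1 ∈ Complex.slitPlane) :
    logMultGamma (n + 1) (z + 1) - logMultGamma (n + 1) z = logMultGamma n z := by
  have h1 : logMultGamma (n + 1) (z + 1) = ∑ j ∈ Finset.range (n + 1),
      binomCoeff (n + 1) j (z + 1) * (hurwitzLog j (z + 1) - hurwitzLog j 1) +
      Complex.log (z + 1) * (binomPoly n).eval 0 := by
    have h2 := sum_binomCoeff_mul_pow (n := n + 1) (by omega) (z + 1) (z + 1)
    rw [sub_self, Nat.add_sub_cancel] at h2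
    rw [← h2, Finset.mul_sum, ← Finset.sum_add_distrib, logMultGamma]
    refine Finset.sum_congr rfl fun j _ => ?_
    rw [hurwitzLog_add_one j hz]
    ring
  rw [h1]
  rcases n with _ | n
  · simp [logMultGamma, binomCoeff_one_zero, binomPoly_zero]
  · rw [binomPoly_eval_zero n.succ_ne_zero, mul_zero, add_zero]
    simp only [logMultGamma, binomCoeff_add_one, add_mul, Finset.sum_add_distrib, add_sub_cancel_left]
    rw [Finset.sum_range_succ, binomCoeff_eq_zero (by omega : n + 1 - 1 < n + 1), zero_mul, add_zero]

/-- The plane cut along `(-∞, -1]`. -/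
def cutPlane : Set ℂ := {z | z + 1 ∈ Complex.slitPlane}

theorem isOpen_cutPlane : IsOpen cutPlane :=
  Complex.isOpen_slitPlane.preimage (continuous_id.add continuous_const)

theorem differentiable_binomCoeff (n j : ℕ) : Differentiable ℂ (binomCoeff n j) := by
  have : binomCoeff n j = fun z => (-1) ^ j * (derivative^[j] (binomPoly (n - 1))).eval z /
      (j.factorial : ℂ) := by
    funext z; rw [binomCoeff_eq, binomDeriv_eq]
  rw [this]
  exact ((Polynomial.differentiable _).const_mul _).div_const _

theorem differentiableOn_logMultGamma (n : ℕ) : DifferentiableOn ℂ (logMultGamma n) cutPlane := by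
  intro z hz
  refine DifferentiableAt.differentiableWithinAt ?_
  have hadd : DifferentiableAt ℂ (fun z : ℂ => z + 1) z := differentiableAt_id.add_const 1
  rcases n with _ | n
  · exact hadd.clog hz
  · refine DifferentiableAt.fun_sum fun j _ => ?_
    refine (differentiable_binomCoeff _ _ z).mul (DifferentiableAt.sub_const ?_ _)
    exact DifferentiableAt.fun_comp' z (((differentiableOn_hurwitzLog j).differentiableAt
      (Complex.isOpen_slitPlane.mem_nhds hz))) hadd

/-! ### The terms of the asymptotic series -/

/-- The derivatives of a primitive of `t ↦ binom(-t, n-1) log(z+t)`. -/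
noncomputable def stirlingTower (n : ℕ) (z : ℂ) (i : ℕ) (t : ℂ) : ℂ :=
  ∑ j ∈ Finset.range n, binomCoeff n j z * logTower j i (z + t)

theorem isDerivTower_stirlingTower (n : ℕ) (z : ℂ) :
    IsDerivTower {t | z + t ∈ Complex.slitPlane} (stirlingTower n z) := by
  intro i t ht
  refine HasDerivAt.fun_sum fun j _ => HasDerivAt.const_mul _ ?_
  exact (isDerivTower_logTower j i (z + t) ht).comp_const_add z t

theorem stirlingTower_one {n : ℕ} (hn : 1 ≤ n) (z t : ℂ) :
    stirlingTower n z 1 t = (binomPoly (n - 1)).eval (-t) * Complex.log (z + t) := by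
  have := sum_binomCoeff_mul_pow hn z (z + t)
  rw [sub_add_cancel_left] at this
  rw [← this, Finset.sum_mul]
  exact Finset.sum_congr rfl fun j _ => by rw [logTower_one, mul_assoc]

/-- At `t = 1` the quotient has argument `0`, and `arg(z+1)` lies strictly between `-π` and `π`. By
continuity the sum of the two arguments does not leave that interval near `t = 1`. -/
theorem eventually_log_div {z : ℂ} (hz : z + 1 ∈ Complex.slitPlane) :
    ∀ᶠ t in nhds (1 : ℂ), Complex.log ((z + t) / (z + 1)) =
      Complex.log (z + t) - Complex.log (z + 1) := by
  have h0 := Complex.slitPlane_ne_zero hz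
  have hlt : ∀ᶠ t in nhds (1 : ℂ), ((z + t) / (z + 1)).arg + (z + 1).arg ∈ Set.Ioo (-Real.pi) Real.pi := by
    have hc : ContinuousAt (fun t : ℂ => ((z + t) / (z + 1)).arg + (z + 1).arg) 1 := by
      refine ContinuousAt.add ?_ continuousAt_const
      refine ContinuousAt.comp (g := Complex.arg) (Complex.continuousAt_arg ?_) (by fun_prop)
      rw [div_self h0]
      exact Complex.one_mem_slitPlane
    refine hc (isOpen_Ioo.mem_nhds ?_)
    change ((z + 1) / (z + 1)).arg + (z + 1).arg ∈ Set.Ioo (-Real.pi) Real.pi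
    rw [div_self h0, Complex.arg_one, zero_add]
    exact ⟨Complex.neg_pi_lt_arg _, lt_of_le_of_ne (Complex.arg_le_pi _)
      (Complex.mem_slitPlane_iff_arg.1 hz).1⟩
  have hne : ∀ᶠ t in nhds (1 : ℂ), z + t ≠ 0 :=
    (show ContinuousAt (fun t : ℂ => z + t) 1 by fun_prop).eventually_ne h0
  filter_upwards [hlt, hne] with t ht hne
  have := (Complex.log_mul_eq_add_log_iff (div_ne_zero hne h0) h0).2 ⟨ht.1, ht.2.le⟩
  rw [div_mul_cancel₀ _ h0] at this
  rw [this]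
  ring

theorem stirlingF_eq {n : ℕ} (hn : 1 ≤ n) (k : ℕ) {z : ℂ} (hz : z + 1 ∈ Complex.slitPlane) :
    stirlingF n k z = stirlingTower n z (k + 1) 1 - Complex.log (z + 1) * binomDeriv n k (-1) := by
  have ho : IsOpen {t | z + t ∈ Complex.slitPlane} :=
    Complex.isOpen_slitPlane.preimage (continuous_const.add continuous_id)
  have ht : IsDerivTower {t | z + t ∈ Complex.slitPlane}
      (fun i t => stirlingTower n z (i + 1) t - Complex.log (z + 1) * binomDeriv n i (-t)) := by
    refine ((isDerivTower_stirlingTower n z).shift 1).sub fun i t _ => ?_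
    exact (isDerivTower_binomDeriv n i t (Set.mem_univ t)).const_mul _
  rw [← ht.iteratedDeriv_eq ho k hz, stirlingF]
  refine Filter.EventuallyEq.iteratedDeriv_eq k ?_
  filter_upwards [eventually_log_div hz] with t h
  rw [h, zero_add, stirlingTower_one hn, binomDeriv_zero]
  ring

theorem stirlingF_zero (n : ℕ) {z : ℂ} (hz : z + 1 ∈ Complex.slitPlane) : stirlingF n 0 z = 0 := by
  simp [stirlingF, div_self (Complex.slitPlane_ne_zero hz)]

/-! ### Euler-Maclaurin for polynomials -/

theorem eval_eq_of_periodic {p : ℂ[X]} (h : ∀ t, p.eval (t + 1) = p.eval t) (x y : ℂ) :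
    p.eval x = p.eval y := by
  have hk : ∀ k : ℕ, p.eval (y + k) = p.eval y := by
    intro k
    induction k with
    | zero => simp
    | succ k ih => rw [Nat.cast_succ, ← add_assoc, h, ih]
  have h0 : p - C (p.eval y) = 0 := by
    refine eq_zero_of_infinite_isRoot _ ?_
    refine (Set.infinite_range_of_injective (f := fun k : ℕ => y + (k : ℂ)) ?_).mono ?_
    · intro a b hab
      simpa using hab
    · rintro _ ⟨k, rfl⟩
      simp [IsRoot, hk k]
  have := congrArg (eval x) h0
  simpa [sub_eq_zero] using this

/-- The derivative of index `N + 2` vanishes, so the error estimate holds with bound `0`. -/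
theorem bernoulliDefect_polynomial {p : ℂ[X]} {N : ℕ} (hp : p.natDegree ≤ N + 1) (t : ℂ) :
    bernoulliDefect N (fun i x => (derivative^[i] p).eval x) t = 0 := by
  have := norm_bernoulliDefect_le N (isDerivTower_polynomial p) (a := t)
    (fun _ _ => Set.mem_univ _) (b := 0) (fun s _ => by
      rw [iterate_derivative_eq_zero (by omega)]; simp)
  rw [mul_zero] at this
  exact norm_le_zero_iff.1 this

/-- This computes the coefficient of `log(z+1)`. Let `R` be the primitive of `binom(-t, n-1)` that
vanishes at `t = -z`. Its Bernoulli sum `E` satisfies `E(t+1) - E(t) = binom(-t, n-1)`, while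
`binom(1-t, n)` has the opposite difference. Their sum is a periodic polynomial, hence constant; its
values at `t = 1` and `t = -z` are the two sides. -/
theorem sum_binomCoeff_primitive {n N : ℕ} (hn : 1 ≤ n) (hN : n ≤ N) (z : ℂ) :
    ∑ j ∈ Finset.range n, binomCoeff n j z * ((z + 1) ^ (j + 1) / ((j : ℂ) + 1)) +
      ∑ r ∈ Finset.range N, (_root_.bernoulli (r + 1) : ℂ) / ((r + 1).factorial : ℂ) *
        binomDeriv n r (-1) =
    (binomPoly n).eval (z + 1) + ∑ r ∈ Finset.Icc 1 n,
      (_root_.bernoulli r : ℂ) / (r.factorial : ℂ) * binomDeriv n (r - 1) z := by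
  set R : ℂ[X] := ∑ j ∈ Finset.range n, C (binomCoeff n j z / ((j : ℂ) + 1)) * (C z + X) ^ (j + 1)
    with hR
  have hRe : ∀ t, R.eval t = ∑ j ∈ Finset.range n,
      binomCoeff n j z * ((z + t) ^ (j + 1) / ((j : ℂ) + 1)) := by
    intro t
    rw [hR, eval_finsetSum]
    refine Finset.sum_congr rfl fun j _ => ?_
    simp
    ring
  have hdeg : R.natDegree ≤ N + 1 := by
    refine natDegree_sum_le_of_forall_le _ _ fun j hj => ?_
    refine (natDegree_C_mul_le _ _).trans (natDegree_pow_le.trans ?_)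
    have h1 : (C z + X : ℂ[X]).natDegree ≤ 1 :=
      natDegree_add_le_of_degree_le ((natDegree_C z).le.trans zero_le_one) natDegree_X_le
    have := Finset.mem_range.1 hj
    calc (j + 1) * (C z + X : ℂ[X]).natDegree ≤ (j + 1) * 1 := Nat.mul_le_mul_left _ h1
      _ ≤ N + 1 := by omega
  have hder : derivative R = (binomPoly (n - 1)).comp (C 0 - X) := by
    refine Polynomial.funext fun t => ?_
    have h1 := sum_binomCoeff_mul_pow hn z (z + t)
    rw [sub_add_cancel_left] at h1
    rw [eval_comp]
    simp only [eval_sub, eval_C, eval_X, zero_sub]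
    rw [← h1, hR, derivative_sum, eval_finsetSum]
    refine Finset.sum_congr rfl fun j _ => ?_
    have : (j : ℂ) + 1 ≠ 0 := by exact_mod_cast j.succ_ne_zero
    simp [derivative_pow]
    field_simp
  have hder' : ∀ i t, (derivative^[i + 1] R).eval t = binomDeriv n i (-t) := by
    intro i t
    rw [Function.iterate_succ_apply, hder, iterate_derivative_comp_C_sub_X, binomDeriv_eq]
    simp
  set E : ℂ[X] := ∑ r ∈ Finset.range (N + 1),
    C ((_root_.bernoulli r : ℂ) / (r.factorial : ℂ)) * derivative^[r] R with hE
  have hEe : ∀ t, E.eval t = bernoulliSum N (fun i x => (derivative^[i] R).eval x) t := by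
    intro t
    rw [hE, eval_finsetSum, bernoulliSum]
    exact Finset.sum_congr rfl fun r _ => by simp
  have hEs : ∀ t, E.eval t = R.eval t + ∑ r ∈ Finset.range N,
      (_root_.bernoulli (r + 1) : ℂ) / ((r + 1).factorial : ℂ) * binomDeriv n r (-t) := by
    intro t
    rw [hEe, bernoulliSum, Finset.sum_range_succ', add_comm]
    simp only [hder']
    simp
  have hper : ∀ t, (E + (binomPoly n).comp (C 1 - X)).eval (t + 1) =
      (E + (binomPoly n).comp (C 1 - X)).eval t := by
    intro t
    have h1 := bernoulliDefect_polynomial hdeg t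
    rw [bernoulliDefect, ← hEe, ← hEe] at h1
    have h2 := hder' 0 t
    rw [zero_add] at h2
    rw [h2, binomDeriv_zero] at h1
    have h3 := binomPoly_eval_add_one (n - 1) (-t)
    rw [Nat.sub_add_cancel hn] at h3
    simp only [eval_add, eval_comp, eval_sub, eval_C, eval_X]
    rw [show (1 : ℂ) - (t + 1) = -t by ring, show (1 : ℂ) - t = -t + 1 by ring, h3]
    linear_combination h1
  have key := eval_eq_of_periodic hper 1 (-z)
  simp only [eval_add, eval_comp, eval_sub, eval_C, eval_X, hEs, hRe, sub_self, neg_neg] at key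
  rw [binomPoly_eval_zero (by omega), add_zero] at key
  rw [key, sub_neg_eq_add, add_comm 1 z, add_comm]
  congr 1
  rw [add_neg_cancel]
  simp only [ne_eq, Nat.add_eq_zero_iff, one_ne_zero, and_false, not_false_eq_true, zero_pow, zero_div,
    mul_zero, Finset.sum_const_zero, zero_add]
  have hshift := Finset.sum_Ico_add' (fun r =>
    (_root_.bernoulli r : ℂ) / (r.factorial : ℂ) * binomDeriv n (r - 1) z) 0 N 1
  simp only [Nat.add_sub_cancel] at hshift
  rw [Finset.range_eq_Ico, hshift]
  symm
  refine Finset.sum_subset_zero_on_sdiff ?_ ?_ fun _ _ => rfl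
  · intro r hr
    simp only [Finset.mem_Icc, Finset.mem_Ico] at hr ⊢
    omega
  · intro r hr
    simp only [Finset.mem_sdiff, Finset.mem_Icc, Finset.mem_Ico] at hr
    rw [binomDeriv_eq_zero (by omega), mul_zero]

/-- Only even Bernoulli indices survive: `B_1` multiplies `F_{n,0}`, which is zero because the
logarithm vanishes at `t = 1`, and the later odd Bernoulli numbers are zero. -/
theorem sum_bernoulli_mul_stirlingF (n M : ℕ) {z : ℂ} (hz : z + 1 ∈ Complex.slitPlane) :
    ∑ r ∈ Finset.range (2 * M), (_root_.bernoulli (r + 1) : ℂ) / ((r + 1).factorial : ℂ) *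
      stirlingF n r z = ∑ r ∈ Finset.Icc 1 M, stirlingTerm n r z := by
  induction M with
  | zero => simp
  | succ M ih =>
    rw [show 2 * (M + 1) = 2 * M + 1 + 1 by ring, Finset.sum_range_succ, Finset.sum_range_succ, ih,
      Finset.sum_Icc_succ_top (by omega), stirlingTerm]
    have h0 : (_root_.bernoulli (2 * M + 1) : ℂ) / ((2 * M + 1).factorial : ℂ) *
        stirlingF n (2 * M) z = 0 := by
      rcases M with _ | M
      · simp [stirlingF_zero n hz]
      · rw [bernoulli_eq_zero_of_odd ⟨M + 1, rfl⟩ (by omega)]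
        simp
    rw [h0, add_zero, show 2 * (M + 1) = 2 * M + 1 + 1 by ring, Nat.add_sub_cancel]

/-- The explicit part of the Euler-Maclaurin formula is the explicit part of the higher Stirling
formula. -/
theorem sum_binomCoeff_mul_bernoulliSum {n M : ℕ} (hn : 1 ≤ n) (hM : n ≤ 2 * M) {z : ℂ}
    (hz : z + 1 ∈ Complex.slitPlane) :
    ∑ j ∈ Finset.range n, binomCoeff n j z *
      (bernoulliSum (2 * M) (logTower j) (z + 1) - deriv riemannZeta (-(j : ℂ))) =
    stirlingMain n z + ∑ r ∈ Finset.Icc 1 M, stirlingTerm n r z := by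
  have h1 : ∑ j ∈ Finset.range n, binomCoeff n j z * bernoulliSum (2 * M) (logTower j) (z + 1) =
      ∑ r ∈ Finset.range (2 * M + 1), (_root_.bernoulli r : ℂ) / (r.factorial : ℂ) *
        stirlingTower n z r 1 := by
    simp only [bernoulliSum, stirlingTower, Finset.mul_sum]
    rw [Finset.sum_comm]
    exact Finset.sum_congr rfl fun r _ => Finset.sum_congr rfl fun j _ => by ring
  -- Each level above `0` splits into a term of the asymptotic series and a multiple of `log(z+1)`.
  -- Those multiples join the logarithmic part of level `0`, and `sum_binomCoeff_primitive`
  -- evaluates the total.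
  have h2 : ∀ r, stirlingTower n z (r + 1) 1 =
      stirlingF n r z + Complex.log (z + 1) * binomDeriv n r (-1) := by
    intro r
    rw [stirlingF_eq hn r hz]
    ring
  have h3 : stirlingTower n z 0 1 = Complex.log (z + 1) *
      ∑ j ∈ Finset.range n, binomCoeff n j z * ((z + 1) ^ (j + 1) / ((j : ℂ) + 1)) -
      ∑ j ∈ Finset.range n, binomCoeff n j z * ((z + 1) ^ (j + 1) / ((j : ℂ) + 1) ^ 2) := by
    rw [stirlingTower, Finset.mul_sum, ← Finset.sum_sub_distrib]
    refine Finset.sum_congr rfl fun j _ => ?_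
    rw [logTower_zero]
    ring
  have h4 : ∑ r ∈ Finset.Icc 1 n,
      binomDeriv n (r - 1) z * (1 / ((r.factorial : ℂ) * (r : ℂ))) * ((z + 1) ^ r - 1) =
      ∑ j ∈ Finset.range n, binomCoeff n j z * (((z + 1) ^ (j + 1) - 1) / ((j : ℂ) + 1) ^ 2) := by
    have hshift := Finset.sum_Ico_add' (fun r =>
      binomDeriv n (r - 1) z * (1 / ((r.factorial : ℂ) * (r : ℂ))) * ((z + 1) ^ r - 1)) 0 n 1
    simp only [Nat.add_sub_cancel] at hshift
    rw [Finset.range_eq_Ico, show Finset.Icc 1 n = Finset.Ico (0 + 1) (n + 1) by ext; simp,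
      ← hshift]
    refine Finset.sum_congr rfl fun j _ => ?_
    have a1 : (j.factorial : ℂ) ≠ 0 := by exact_mod_cast j.factorial_ne_zero
    have a2 : (j : ℂ) + 1 ≠ 0 := by exact_mod_cast j.succ_ne_zero
    rw [binomCoeff_eq, Nat.factorial_succ]
    push_cast
    field_simp
  have h5 := sum_binomCoeff_primitive hn hM z
  have h6 := sum_bernoulli_mul_stirlingF n M hz
  have h7 : ∑ r ∈ Finset.range (2 * M), (_root_.bernoulli (r + 1) : ℂ) / ((r + 1).factorial : ℂ) *
      stirlingTower n z (r + 1) 1 = ∑ r ∈ Finset.Icc 1 M, stirlingTerm n r z +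
        Complex.log (z + 1) * ∑ r ∈ Finset.range (2 * M),
          (_root_.bernoulli (r + 1) : ℂ) / ((r + 1).factorial : ℂ) * binomDeriv n r (-1) := by
    rw [← h6, Finset.mul_sum, ← Finset.sum_add_distrib]
    exact Finset.sum_congr rfl fun r _ => by rw [h2]; ring
  have h8 : ∑ j ∈ Finset.range n, binomCoeff n j z * (((z + 1) ^ (j + 1) - 1) / ((j : ℂ) + 1) ^ 2) =
      ∑ j ∈ Finset.range n, binomCoeff n j z * ((z + 1) ^ (j + 1) / ((j : ℂ) + 1) ^ 2) -
        ∑ j ∈ Finset.range n, binomCoeff n j z * (1 / ((j : ℂ) + 1) ^ 2) := by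
    rw [← Finset.sum_sub_distrib]
    exact Finset.sum_congr rfl fun j _ => by ring
  simp only [mul_sub, Finset.sum_sub_distrib]
  rw [h1, Finset.sum_range_succ', h3, h7, stirlingMain, h4, ← h5, h8]
  simp only [mul_add, Finset.sum_add_distrib, _root_.bernoulli_zero, Nat.factorial_zero]
  push_cast
  ring

/-- The higher Stirling formula with an explicit remainder. -/
theorem logMultGamma_eq {n M : ℕ} (hn : 1 ≤ n) (hM : n ≤ 2 * M) {z : ℂ} (hz : z ∈ cutPlane) :
    logMultGamma n z = stirlingMain n z + ∑ r ∈ Finset.Icc 1 M, stirlingTerm n r z +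
      ∑ j ∈ Finset.range n, binomCoeff n j z * logRemainder (2 * M) j (z + 1) := by
  rw [← sum_binomCoeff_mul_bernoulliSum hn hM hz, ← Finset.sum_add_distrib]
  obtain ⟨m, rfl⟩ := Nat.exists_eq_add_of_le' hn
  rw [logMultGamma]
  refine Finset.sum_congr rfl fun j hj => ?_
  have := Finset.mem_range.1 hj
  rw [hurwitzLog_eq (N := 2 * M) (by omega) hz, hurwitzLog_one]
  ring

/-! ### The order of the terms of the asymptotic series -/

/-- Over `ℕ` the value at `1` is a sum of coefficients without cancellation, and the leading one is
nonzero. -/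
theorem eval_one_iterate_derivative_ascPochhammer_ne_zero {m i : ℕ} (hi : i ≤ m) :
    (derivative^[i] (ascPochhammer ℕ m)).eval 1 ≠ 0 := by
  have hc : (derivative^[i] (ascPochhammer ℕ m)).coeff (m - i) ≠ 0 := by
    have hm : (ascPochhammer ℕ m).coeff m = 1 := by
      have := (monic_ascPochhammer ℕ m).coeff_natDegree
      rwa [ascPochhammer_natDegree] at this
    rw [coeff_iterate_derivative, Nat.sub_add_cancel hi, hm]
    simpa [Nat.descFactorial_eq_zero_iff_lt] using hi
  intro h
  rw [eval_eq_sum, Polynomial.sum, Finset.sum_eq_zero_iff] at h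
  have := h (m - i) (mem_support_iff.2 hc)
  simp at this
  exact hc this

/-- Up to a nonzero factor, `binom(-t, n-1)` is the rising factorial, whose derivatives do not
vanish at `1` up to its degree. This keeps the leading coefficient of `F_{n,k}` from vanishing. -/
theorem binomDeriv_neg_one_ne_zero {n i : ℕ} (hi : i ≤ n - 1) : binomDeriv n i (-1) ≠ 0 := by
  set m := n - 1 with hm
  have h1 : (descPochhammer ℂ m).comp (C 0 - X) = C ((-1) ^ m) * ascPochhammer ℂ m := by
    refine Polynomial.funext fun t => ?_
    have := ascPochhammer_eval_neg_eq_descPochhammer ℂ (-t) m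
    simp only [eval_comp, eval_sub, eval_C, eval_X, zero_sub, eval_mul]
    rw [neg_neg] at this
    rw [this, ← mul_assoc, ← pow_add, ← two_mul, pow_mul]
    simp
  have h2 : binomDeriv n i (-1) =
      ((m.factorial : ℂ)⁻¹) * ((-1) ^ m * ((derivative^[i] (ascPochhammer ℂ m)).eval 1)) := by
    have h3 := congrArg (fun p => (derivative^[i] p).eval 1) h1
    simp only [iterate_derivative_comp_C_sub_X, iterate_derivative_C_mul, eval_mul, eval_C, eval_comp,
      eval_sub, eval_X, zero_sub] at h3
    rw [← h3, binomDeriv_eq, ← hm, binomPoly, iterate_derivative_C_mul, eval_mul, eval_C]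
    ring
  rw [h2, ← ascPochhammer_map (Nat.castRingHom ℂ), iterate_derivative_map]
  have h4 := eval_one_iterate_derivative_ascPochhammer_ne_zero hi
  have a1 : (m.factorial : ℂ) ≠ 0 := by exact_mod_cast m.factorial_ne_zero
  rw [eval_one_map]
  refine mul_ne_zero (inv_ne_zero a1) (mul_ne_zero (pow_ne_zero _ (by norm_num)) ?_)
  simpa using h4

/-- The derivatives of `t ↦ log ((z + t) / (z + 1))`. -/
noncomputable def logDivTower (z : ℂ) : ℕ → ℂ → ℂ
  | 0, t => Complex.log ((z + t) / (z + 1))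
  | m + 1, t => (-1) ^ m * (m.factorial : ℂ) * ((z + t) ^ (m + 1))⁻¹

theorem isDerivTower_logDivTower {z : ℂ} (hz : z + 1 ≠ 0) :
    IsDerivTower {t | (z + t) / (z + 1) ∈ Complex.slitPlane} (logDivTower z) := by
  intro m t ht
  have hne : z + t ≠ 0 := fun h => by
    have := Complex.slitPlane_ne_zero ht
    simp [h] at this
  have hadd : HasDerivAt (fun t : ℂ => z + t) 1 t := (hasDerivAt_id t).const_add z
  rcases m with _ | m
  · refine ((hadd.div_const (z + 1)).clog ht).congr_deriv ?_
    simp [logDivTower]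
    field_simp
  · have h := ((hadd.fun_pow (m + 1)).fun_inv (pow_ne_zero _ hne)).const_mul
      ((-1) ^ m * (m.factorial : ℂ))
    refine h.congr_deriv ?_
    rw [logDivTower, Nat.factorial_succ]
    push_cast
    field_simp
    ring

/-- Leibniz's rule for `stirlingF`. -/
theorem stirlingF_eq_sum (n k : ℕ) {z : ℂ} (hz : z + 1 ≠ 0) :
    stirlingF n k z = ∑ i ∈ Finset.range k, (k.choose i : ℂ) * binomDeriv n i (-1) *
      ((-1) ^ (k - i - 1) * ((k - i - 1).factorial : ℂ) * ((z + 1) ^ (k - i))⁻¹) := by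
  have ho : IsOpen {t : ℂ | (z + t) / (z + 1) ∈ Complex.slitPlane} :=
    Complex.isOpen_slitPlane.preimage ((continuous_const.add continuous_id).div_const _)
  have h1 : (1 : ℂ) ∈ {t : ℂ | (z + t) / (z + 1) ∈ Complex.slitPlane} := by
    change (z + 1) / (z + 1) ∈ Complex.slitPlane
    rw [div_self hz]
    exact Complex.one_mem_slitPlane
  have hlog := isDerivTower_logDivTower hz
  have hP := isDerivTower_binomDeriv n
  have hdiff : DifferentiableOn ℂ (logDivTower z 0)
      {t : ℂ | (z + t) / (z + 1) ∈ Complex.slitPlane} :=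
    fun t ht => (hlog 0 t ht).differentiableAt.differentiableWithinAt
  have hdiffP : Differentiable ℂ (fun t => binomDeriv n 0 (-t)) :=
    fun t => (hP 0 t (Set.mem_univ t)).differentiableAt
  have e : (fun t : ℂ => (binomPoly (n - 1)).eval (-t) * Complex.log ((z + t) / (z + 1))) =
      fun t => binomDeriv n 0 (-t) * logDivTower z 0 t := by
    funext t
    rw [binomDeriv_zero, logDivTower]
  rw [stirlingF, e, iteratedDeriv_fun_mul hdiffP.contDiff.contDiffAt
    ((hdiff.contDiffOn ho).contDiffAt (ho.mem_nhds h1)), Finset.sum_range_succ, Nat.sub_self,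
    iteratedDeriv_zero]
  have h0 : logDivTower z 0 1 = 0 := by simp [logDivTower, div_self hz]
  rw [h0, mul_zero, add_zero]
  refine Finset.sum_congr rfl fun i hi => ?_
  have hi := Finset.mem_range.1 hi
  rw [hP.iteratedDeriv_eq isOpen_univ i (Set.mem_univ 1), hlog.iteratedDeriv_eq ho (k - i) h1]
  obtain ⟨m, hm⟩ : ∃ m, k - i = m + 1 := ⟨k - i - 1, by omega⟩
  rw [hm, logDivTower, Nat.add_sub_cancel]

theorem tendsto_add_one_cobounded :
    Tendsto (fun z : ℂ => z + 1) (Bornology.cobounded ℂ) (Bornology.cobounded ℂ) :=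
  tendsto_add_const_cobounded 1

theorem isTheta_add_one :
    (fun z : ℂ => z + 1) =Θ[Bornology.cobounded ℂ] fun z => z :=
  (IsEquivalent.refl.add_isLittleO (isLittleO_const_id_cobounded (1 : ℂ))).isTheta

theorem eventually_cobounded_add_one_ne_zero : ∀ᶠ z in Bornology.cobounded ℂ, z + 1 ≠ 0 :=
  tendsto_add_one_cobounded.eventually (Bornology.eventually_ne_cobounded (0 : ℂ))

/-- In Leibniz's rule the slowest decay comes from the term with as many derivatives as possible on
the polynomial. There are at most `n - 1` of these, since further ones vanish, and at most `k - 1`,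
since the undifferentiated logarithm is zero at `t = 1`. -/
theorem isTheta_stirlingF {n k : ℕ} (hk : 1 ≤ k) : stirlingF n k =Θ[Bornology.cobounded ℂ]
    fun z => (z ^ (k - min (k - 1) (n - 1)))⁻¹ := by
  set i₀ := min (k - 1) (n - 1) with hi₀
  set c : ℕ → ℂ := fun i => (k.choose i : ℂ) * binomDeriv n i (-1) *
      ((-1) ^ (k - i - 1) * ((k - i - 1).factorial : ℂ)) with hc
  have hc0 : c i₀ ≠ 0 := by
    refine mul_ne_zero (mul_ne_zero ?_ (binomDeriv_neg_one_ne_zero (min_le_right _ _)))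
      (mul_ne_zero (pow_ne_zero _ (by norm_num)) ?_)
    · exact_mod_cast (Nat.choose_pos (by omega)).ne'
    · exact_mod_cast Nat.factorial_ne_zero _
  have hF : stirlingF n k =ᶠ[Bornology.cobounded ℂ] fun z => ((z + 1) ^ (k - i₀))⁻¹ *
      ∑ i ∈ Finset.range (i₀ + 1), c i * ((z + 1)⁻¹) ^ (i₀ - i) := by
    filter_upwards [eventually_cobounded_add_one_ne_zero] with z hz
    rw [stirlingF_eq_sum n k hz, Finset.mul_sum]
    symm
    refine Finset.sum_subset_zero_on_sdiff ?_ ?_ ?_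
    · intro i hi
      simp only [Finset.mem_range] at hi ⊢
      omega
    · intro i hi
      simp only [Finset.mem_sdiff, Finset.mem_range] at hi
      rw [binomDeriv_eq_zero (by omega)]
      ring
    · intro i hi
      have hi := Finset.mem_range.1 hi
      rw [show k - i = (k - i₀) + (i₀ - i) by omega, pow_add, mul_inv, inv_pow, hc]
      simp only
      rw [show k - i = (k - i₀) + (i₀ - i) by omega]
      ring
  have hT : Tendsto (fun z : ℂ => ∑ i ∈ Finset.range (i₀ + 1), c i * ((z + 1)⁻¹) ^ (i₀ - i))
      (Bornology.cobounded ℂ) (nhds (c i₀)) := by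
    have h1 := tendsto_finsetSum (Finset.range (i₀ + 1)) fun i _ =>
      ((((tendsto_inv₀_cobounded (α := ℂ)).comp tendsto_add_one_cobounded).pow (i₀ - i)).const_mul (c i))
    have h2 : ∑ i ∈ Finset.range (i₀ + 1), c i * (0 : ℂ) ^ (i₀ - i) = c i₀ := by
      rw [Finset.sum_range_succ, Finset.sum_eq_zero, Nat.sub_self, pow_zero, zero_add, mul_one]
      intro i hi
      have := Finset.mem_range.1 hi
      rw [zero_pow (by omega), mul_zero]
    rw [h2] at h1
    exact h1
  have hΘ := ((isEquivalent_const_iff_tendsto hc0).2 hT).isTheta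
  have h1 : (fun z : ℂ => ((z + 1) ^ (k - i₀))⁻¹ *
      ∑ i ∈ Finset.range (i₀ + 1), c i * ((z + 1)⁻¹) ^ (i₀ - i)) =Θ[Bornology.cobounded ℂ]
      fun z => (z ^ (k - i₀))⁻¹ * c i₀ := (isTheta_add_one.pow (k - i₀)).inv.mul hΘ
  refine (hF.isTheta.trans h1).trans ?_
  simp only [mul_comm _ (c i₀)]
  exact (isTheta_refl _ _).const_mul_left hc0

/-- By Euler's formula a vanishing `B_{2m}` would give `ζ(2m) = 0`, against the nonvanishing of `ζ`
on `Re s ≥ 1`. -/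
theorem bernoulli_two_mul_ne_zero {m : ℕ} (hm : m ≠ 0) : _root_.bernoulli (2 * m) ≠ 0 := by
  intro h
  have h1 := riemannZeta_two_mul_nat hm
  rw [h] at h1
  refine riemannZeta_ne_zero_of_one_le_re (s := 2 * (m : ℂ)) ?_ (by rw [h1]; simp)
  have : (1 : ℝ) ≤ m := by exact_mod_cast Nat.one_le_iff_ne_zero.2 hm
  simp
  linarith

theorem isTheta_stirlingTerm {n r : ℕ} (hr : 1 ≤ r) : stirlingTerm n r =Θ[Bornology.cobounded ℂ]
    fun z => (z ^ (2 * r - 1 - min (2 * r - 2) (n - 1)))⁻¹ := by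
  have h := isTheta_stirlingF (n := n) (k := 2 * r - 1) (by omega)
  rw [show 2 * r - 1 - 1 = 2 * r - 2 by omega] at h
  refine IsTheta.const_mul_left ?_ h
  refine div_ne_zero ?_ ?_
  · exact_mod_cast bernoulli_two_mul_ne_zero (by omega)
  · exact_mod_cast Nat.factorial_ne_zero _

/-! ### The asymptotic series -/

theorem isLittleO_inv_pow {a b : ℕ} (h : b < a) :
    (fun z : ℂ => (z ^ a)⁻¹) =o[Bornology.cobounded ℂ] fun z => (z ^ b)⁻¹ := by
  have h1 : Tendsto (fun z : ℂ => (z⁻¹) ^ (a - b)) (Bornology.cobounded ℂ) (nhds 0) := by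
    have := (tendsto_inv₀_cobounded (α := ℂ)).pow (a - b)
    rwa [zero_pow (by omega)] at this
  have h2 := (isBigO_refl (fun z : ℂ => (z ^ b)⁻¹) (Bornology.cobounded ℂ)).mul_isLittleO
    ((isLittleO_one_iff ℂ).2 h1)
  simp only [mul_one] at h2
  refine h2.congr_left fun z => ?_
  rw [inv_pow, ← mul_inv, ← pow_add]
  congr 2
  omega

theorem isBigO_inv_pow {a b : ℕ} (h : b ≤ a) :
    (fun z : ℂ => (z ^ a)⁻¹) =O[Bornology.cobounded ℂ] fun z => (z ^ b)⁻¹ := by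
  rcases h.eq_or_lt with rfl | h
  · exact isBigO_refl _ _
  · exact (isLittleO_inv_pow h).isBigO

theorem isBigO_eval_polynomial {p : ℂ[X]} {n : ℕ} (hp : p.natDegree ≤ n) :
    (fun z => p.eval z) =O[Bornology.cobounded ℂ] fun z => z ^ n := by
  have e : (fun z => p.eval z) = fun z => ∑ i ∈ Finset.range (n + 1), p.coeff i * z ^ i := by
    funext z
    exact eval_eq_sum_range' (by omega) z
  rw [e]
  refine IsBigO.fun_sum fun i hi => IsBigO.const_mul_left ?_ _
  have hi := Finset.mem_range.1 hi
  refine IsBigO.of_bound 1 ?_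
  filter_upwards [tendsto_norm_cobounded_atTop.eventually_ge_atTop 1] with z hz
  rw [one_mul, norm_pow, norm_pow]
  exact pow_le_pow_right₀ hz (by omega)

theorem atInftySector_le (δ : ℝ) : atInftySector δ ≤ Bornology.cobounded ℂ := inf_le_left

theorem exists_eventually_wedge {δ : ℝ} (h0 : 0 < δ) (hpi : δ < Real.pi) :
    ∃ c : ℝ, 0 < c ∧ ∀ᶠ z in atInftySector δ, z + 1 ∈ wedge c ∧ 1 ≤ ‖z + 1‖ := by
  obtain ⟨c, hc, hsub⟩ := sector_subset_wedge h0 hpi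
  refine ⟨c, hc, Filter.Eventually.and ?_ ?_⟩
  · have : ∀ᶠ z in atInftySector δ, z ∈ {z : ℂ | |z.arg| < Real.pi - δ} :=
      (inf_le_right : atInftySector δ ≤ _) (mem_principal_self _)
    filter_upwards [this] with z hz
    have := wedge_add hc.le (hsub hz) zero_le_one
    simpa using this
  · exact atInftySector_le δ ((tendsto_norm_cobounded_atTop.comp
      tendsto_add_one_cobounded).eventually_ge_atTop 1)

theorem eventually_mem_cutPlane {δ : ℝ} (h0 : 0 < δ) (hpi : δ < Real.pi) :
    ∀ᶠ z in atInftySector δ, z ∈ cutPlane := by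
  obtain ⟨c, hc, h⟩ := exists_eventually_wedge h0 hpi
  filter_upwards [h] with z hz
  exact mem_slitPlane_of_mem_wedge hc hz.1 (norm_pos_iff.1 (one_pos.trans_le hz.2))

theorem isBigO_binomCoeff (n j : ℕ) :
    binomCoeff n j =O[Bornology.cobounded ℂ] fun z => z ^ (n - 1) := by
  have : binomCoeff n j = fun z => ((-1) ^ j / (j.factorial : ℂ)) *
      (derivative^[j] (binomPoly (n - 1))).eval z := by
    funext z; rw [binomCoeff_eq, binomDeriv_eq]; ring
  rw [this]
  refine IsBigO.const_mul_left (isBigO_eval_polynomial ?_) _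
  exact (natDegree_iterate_derivative _ _).trans ((Nat.sub_le _ _).trans (natDegree_binomPoly_le _))

theorem isBigO_logRemainder {N j : ℕ} (hN : j + 1 ≤ N) {δ : ℝ} (h0 : 0 < δ) (hpi : δ < Real.pi) :
    (fun z => logRemainder N j (z + 1)) =O[atInftySector δ] fun z => (z ^ (N - 1 - j))⁻¹ := by
  obtain ⟨c, hc, h⟩ := exists_eventually_wedge h0 hpi
  obtain ⟨K, hK⟩ := norm_logRemainder_le hN hc
  have h1 : (fun z => logRemainder N j (z + 1)) =O[atInftySector δ]
      fun z => ((z + 1) ^ (N - 1 - j))⁻¹ := by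
    refine IsBigO.of_bound K ?_
    filter_upwards [h] with z hz
    simpa using hK _ hz.1 hz.2
  exact h1.trans (((isTheta_add_one.pow (N - 1 - j)).inv.isBigO).mono (atInftySector_le δ))

theorem isBigO_remainder {n M q : ℕ} (hM : 2 * n + q ≤ 2 * M) {δ : ℝ} (h0 : 0 < δ)
    (hpi : δ < Real.pi) :
    (fun z => ∑ j ∈ Finset.range n, binomCoeff n j z * logRemainder (2 * M) j (z + 1))
      =O[atInftySector δ] fun z => (z ^ q)⁻¹ := by
  refine IsBigO.fun_sum fun j hj => ?_
  have hj := Finset.mem_range.1 hj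
  refine (((isBigO_binomCoeff n j).mono (atInftySector_le δ)).mul
    (isBigO_logRemainder (N := 2 * M) (by omega) h0 hpi)).trans ?_
  refine IsBigO.trans (g := fun z : ℂ => (z ^ (2 * M - 1 - j - (n - 1)))⁻¹) ?_
    ((isBigO_inv_pow (by omega)).mono (atInftySector_le δ))
  refine IsBigO.of_bound 1 ?_
  filter_upwards [atInftySector_le δ (Bornology.eventually_ne_cobounded (0 : ℂ))] with z hz
  rw [one_mul]
  refine le_of_eq (congrArg _ ?_)
  have hp := pow_ne_zero (n - 1) hz
  rw [show 2 * M - 1 - j = (2 * M - 1 - j - (n - 1)) + (n - 1) by omega, pow_add, Nat.add_sub_cancel]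
  field_simp

theorem isLittleO_logMultGamma {n m : ℕ} (hn : 1 ≤ n) (hm : 1 ≤ m) (hnm : n ≤ 2 * m) {δ : ℝ}
    (h0 : 0 < δ) (hpi : δ < Real.pi) :
    (fun z => logMultGamma n z - (stirlingMain n z + ∑ r ∈ Finset.Icc 1 m, stirlingTerm n r z))
      =o[atInftySector δ] stirlingTerm n m := by
  have hΘ := (isTheta_stirlingTerm (n := n) hm).mono (atInftySector_le δ)
  refine IsLittleO.trans_isTheta ?_ hΘ.symm
  set p := 2 * m - 1 - min (2 * m - 2) (n - 1) with hp
  -- Expand beyond the required order: with this `M` the exact remainder is `O(z^{-(2m+2)})`,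
  -- although the coefficients `G_{n,j}(z)` grow like `z^{n-1}`. The surplus terms are estimated one
  -- by one.
  set M := m + n + 1 with hM
  have h1 : (fun z => logMultGamma n z -
      (stirlingMain n z + ∑ r ∈ Finset.Icc 1 m, stirlingTerm n r z)) =ᶠ[atInftySector δ]
      fun z => ∑ r ∈ Finset.Ioc m M, stirlingTerm n r z +
        ∑ j ∈ Finset.range n, binomCoeff n j z * logRemainder (2 * M) j (z + 1) := by
    filter_upwards [eventually_mem_cutPlane h0 hpi] with z hz
    have hs : ∑ r ∈ Finset.Icc 1 m, stirlingTerm n r z + ∑ r ∈ Finset.Ioc m M, stirlingTerm n r z =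
        ∑ r ∈ Finset.Icc 1 M, stirlingTerm n r z := by
      rw [← Finset.sum_union]
      · congr 1
        ext r
        simp only [Finset.mem_union, Finset.mem_Icc, Finset.mem_Ioc]
        omega
      · rw [Finset.disjoint_left]
        intro r hr hr'
        simp only [Finset.mem_Icc, Finset.mem_Ioc] at hr hr'
        omega
    rw [logMultGamma_eq (M := M) hn (by omega) hz, ← hs]
    ring
  refine h1.trans_isLittleO (IsLittleO.add (IsLittleO.fun_sum fun r hr => ?_) ?_)
  · have hr := Finset.mem_Ioc.1 hr
    refine IsLittleO.mono ?_ (atInftySector_le δ)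
    -- Here `n ≤ 2m` matters: for smaller `m` consecutive terms may both have order `1/z`, but every
    -- term with `r > m` now decays strictly faster than the `m`-th.
    exact (isTheta_stirlingTerm (n := n) (by omega)).isBigO.trans_isLittleO
      (isLittleO_inv_pow (by omega))
  · exact (isBigO_remainder (q := 2 * m + 2) (by omega) h0 hpi).trans_isLittleO
      ((isLittleO_inv_pow (by omega)).mono (atInftySector_le δ))

/-- For `n < 2m` both minima in the exact orders equal `n - 1`, so the exponent grows by exactly
`2`. -/
theorem isBigO_stirlingF_step {n m : ℕ} (hn : 1 ≤ n) (hm : n < 2 * m) {δ : ℝ} :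
    stirlingF n (2 * m + 1) =O[atInftySector δ] fun z => (z ^ 2)⁻¹ * stirlingF n (2 * m - 1) z := by
  refine IsBigO.mono ?_ (atInftySector_le δ)
  have h1 := (isTheta_stirlingF (n := n) (k := 2 * m + 1) (by omega)).isBigO
  have h2 := (isTheta_stirlingF (n := n) (k := 2 * m - 1) (by omega)).symm.isBigO
  refine h1.trans (IsBigO.trans (IsBigO.of_bound 1 (Eventually.of_forall fun z => ?_))
    ((isBigO_refl (fun z : ℂ => (z ^ 2)⁻¹) _).mul h2))
  rw [one_mul, ← mul_inv, ← pow_add]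
  rw [show 2 * m + 1 - min (2 * m + 1 - 1) (n - 1) =
    2 + (2 * m - 1 - min (2 * m - 1 - 1) (n - 1)) by omega]

/-! ### The first two levels -/

theorem binomDeriv_two_one (z : ℂ) : binomDeriv 2 1 z = -1 := by
  rw [binomDeriv_eq]
  simp [binomPoly, descPochhammer_one]

theorem stirlingMain_one (z : ℂ) :
    stirlingMain 1 z = (z + 1 / 2) * Complex.log (z + 1) - (z + 1) - deriv riemannZeta 0 := by
  simp [stirlingMain, binomCoeff_one_zero, binomDeriv_zero, binomPoly, descPochhammer_one]
  ring

theorem stirlingMain_two (z : ℂ) :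
    stirlingMain 2 z = (z ^ 2 / 2 - 1 / 12) * Complex.log (z + 1) - 3 / 4 * z ^ 2 - z / 2 + 1 / 4
      - z * deriv riemannZeta 0 + deriv riemannZeta (-1) := by
  have h1 : binomDeriv 2 0 z = z := by simp [binomDeriv_zero, binomPoly, descPochhammer_one]
  have h2 : (binomPoly 2).eval (z + 1) = (z + 1) * z / 2 := by
    rw [binomPoly, descPochhammer_succ_right, descPochhammer_one]
    simp
    ring
  have h3 : Finset.Icc 1 2 = {1, 2} := rfl
  rw [stirlingMain, h2, h3]
  simp [Finset.sum_range_succ, binomCoeff_eq, h1, binomDeriv_two_one, bernoulli_two]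
  ring

theorem stirlingTerm_one {r : ℕ} (hr : 1 ≤ r) {z : ℂ} (hz : z + 1 ≠ 0) :
    stirlingTerm 1 r z = (_root_.bernoulli (2 * r) : ℂ) / (2 * r * (2 * r - 1)) *
      (1 / (z + 1) ^ (2 * r - 1)) := by
  obtain ⟨s, rfl⟩ := Nat.exists_eq_add_of_le' hr
  rw [stirlingTerm, stirlingF_eq_sum 1 _ hz, show 2 * (s + 1) - 1 = 2 * s + 1 by omega,
    Finset.sum_range_succ', Finset.sum_eq_zero fun i _ => by rw [binomDeriv_eq_zero (by omega)]; ring,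
    show 2 * (s + 1) = 2 * s + 1 + 1 by ring, Nat.factorial_succ, Nat.factorial_succ]
  have a1 : ((2 * s).factorial : ℂ) ≠ 0 := by exact_mod_cast Nat.factorial_ne_zero _
  have a2 : (2 * (s : ℂ) + 1) ≠ 0 := by exact_mod_cast (2 * s).succ_ne_zero
  have a3 : (2 * (s : ℂ) + 1 + 1) ≠ 0 := by exact_mod_cast (2 * s + 1).succ_ne_zero
  have a4 : (s : ℂ) + 1 ≠ 0 := by exact_mod_cast s.succ_ne_zero
  simp only [binomDeriv_zero, binomPoly_zero, Nat.sub_self, Nat.choose_zero_right, Nat.sub_zero,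
    Nat.add_sub_cancel, pow_mul, zero_add, eval_one, mul_one]
  push_cast
  rw [show 2 * ((s : ℂ) + 1) - 1 = 2 * s + 1 by ring, show 2 * ((s : ℂ) + 1) = 2 * s + 1 + 1 by ring]
  norm_num
  field_simp

/-- For `n = 2` the first term of the series already has order `1/z`, so it is absorbed into the
error. -/
theorem isBigO_logMultGamma_two {δ : ℝ} (h0 : 0 < δ) (hpi : δ < Real.pi) :
    (fun z => logMultGamma 2 z - ((z ^ 2 / 2 - 1 / 12) * Complex.log (z + 1)
            - 3 / 4 * z ^ 2 - z / 2 + 1 / 4 - z * deriv riemannZeta 0 + deriv riemannZeta (-1)))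
          =O[atInftySector δ] fun z => 1 / z := by
  have h1 := (isLittleO_logMultGamma (n := 2) (m := 1) (by norm_num) le_rfl (by norm_num)
    h0 hpi).isBigO
  have h2 := (isTheta_stirlingTerm (n := 2) (r := 1) le_rfl).isBigO.mono (atInftySector_le δ)
  have h3 := (h1.add (isBigO_refl (stirlingTerm 2 1) _)).trans h2
  refine (h3.congr_left fun z => ?_).congr_right fun z => ?_
  · rw [← stirlingMain_two]
    simp
    ring
  · simp

/-! ### Decay of the high derivatives -/

theorem exists_polynomial_stirlingMain {n : ℕ} (hn : 1 ≤ n) : ∃ p q : ℂ[X],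
    p.natDegree ≤ n ∧ q.natDegree ≤ n ∧
      ∀ z, stirlingMain n z = p.eval z * Complex.log (z + 1) - q.eval z := by
  have hd : ∀ i, (derivative^[i] (binomPoly (n - 1))).natDegree ≤ n - 1 - i := fun i =>
    (natDegree_iterate_derivative _ _).trans (Nat.sub_le_sub_right (natDegree_binomPoly_le _) i)
  have hX : (X + 1 : ℂ[X]).natDegree ≤ 1 :=
    natDegree_add_le_of_degree_le natDegree_X_le (natDegree_one.le.trans zero_le_one)
  refine ⟨(binomPoly n).comp (X + 1) + ∑ r ∈ Finset.Icc 1 n,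
      C ((_root_.bernoulli r : ℂ) / (r.factorial : ℂ) * (-1) ^ (r - 1)) *
        derivative^[r - 1] (binomPoly (n - 1)),
    ∑ r ∈ Finset.Icc 1 n, C ((-1) ^ (r - 1) * (1 / ((r.factorial : ℂ) * (r : ℂ)))) *
        derivative^[r - 1] (binomPoly (n - 1)) * ((X + 1) ^ r - 1) +
      ∑ j ∈ Finset.range n, C ((-1) ^ j / (j.factorial : ℂ) *
        (deriv riemannZeta (-(j : ℂ)) + 1 / ((j : ℂ) + 1) ^ 2)) *
        derivative^[j] (binomPoly (n - 1)), ?_, ?_, fun z => ?_⟩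
  · refine natDegree_add_le_of_degree_le ?_ (natDegree_sum_le_of_forall_le _ _ fun r hr => ?_)
    · refine natDegree_comp_le.trans ?_
      calc (binomPoly n).natDegree * (X + 1 : ℂ[X]).natDegree ≤ n * 1 :=
            Nat.mul_le_mul (natDegree_binomPoly_le n) hX
        _ = n := mul_one n
    · exact (natDegree_C_mul_le _ _).trans ((hd _).trans (by omega))
  · refine natDegree_add_le_of_degree_le (natDegree_sum_le_of_forall_le _ _ fun r hr => ?_)
      (natDegree_sum_le_of_forall_le _ _ fun j hj => ?_)
    · have hr := Finset.mem_Icc.1 hr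
      have h1 : ((X + 1 : ℂ[X]) ^ r - 1).natDegree ≤ r := by
        refine natDegree_sub_le_of_le (natDegree_pow_le.trans ?_) (natDegree_one.le.trans (Nat.zero_le _))
          |>.trans (max_self r).le
        calc r * (X + 1 : ℂ[X]).natDegree ≤ r * 1 := Nat.mul_le_mul_left _ hX
          _ = r := mul_one r
      refine natDegree_mul_le.trans ?_
      have h2 := (natDegree_C_mul_le ((-1) ^ (r - 1) * (1 / ((r.factorial : ℂ) * (r : ℂ))))
        (derivative^[r - 1] (binomPoly (n - 1)))).trans (hd _)
      omega
    · exact (natDegree_C_mul_le _ _).trans ((hd _).trans (by omega))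
  · rw [stirlingMain, sub_sub]
    simp only [eval_add, eval_finsetSum, eval_mul, eval_C, eval_comp, eval_X, eval_one, eval_sub,
      eval_pow, binomCoeff_eq, binomDeriv_eq]
    congr 1
    · congr 2
      exact Finset.sum_congr rfl fun r _ => by ring
    · congr 1 <;> exact Finset.sum_congr rfl fun r _ => by ring

/-- Expanding the coefficient of the logarithm in powers of `z + 1` makes the main part a
combination of `(z+1)^l log(z+1)` with `l ≤ n`, minus a polynomial of degree at most `n`. After `n +
1` derivatives the polynomial is gone and only negative powers of `z + 1` remain. -/
theorem exists_tower_stirlingMain {n : ℕ} (hn : 1 ≤ n) : ∃ σ : ℕ → ℂ → ℂ,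
    IsDerivTower cutPlane σ ∧ σ 0 = stirlingMain n ∧
      ∀ k, n + 1 ≤ k → Tendsto (σ k) (Bornology.cobounded ℂ) (nhds 0) := by
  obtain ⟨p, q, hp, hq, h⟩ := exists_polynomial_stirlingMain hn
  set c : ℕ → ℂ := (p.comp (X - 1)).coeff with hc
  have hpc : ∀ z, p.eval z = ∑ l ∈ Finset.range (n + 1), c l * (z + 1) ^ l := by
    intro z
    have hdeg : (p.comp (X - 1)).natDegree < n + 1 := by
      refine Nat.lt_succ_of_le (natDegree_comp_le.trans ?_)
      have hX : (X - 1 : ℂ[X]).natDegree ≤ 1 :=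
        (natDegree_sub_le_of_le natDegree_X_le (natDegree_one.le.trans zero_le_one)).trans
          (max_self 1).le
      calc p.natDegree * (X - 1 : ℂ[X]).natDegree ≤ n * 1 := Nat.mul_le_mul hp hX
        _ = n := mul_one n
    rw [hc, ← eval_eq_sum_range' hdeg]
    simp
  refine ⟨fun i z => ∑ l ∈ Finset.range (n + 1), c l * logTower l (i + 1) (z + 1) -
    (derivative^[i] q).eval z, ?_, ?_, fun k hk => ?_⟩
  · refine IsDerivTower.sub (fun i z hz => ?_)
      ((isDerivTower_polynomial q).mono (Set.subset_univ _))
    refine HasDerivAt.fun_sum fun l _ => HasDerivAt.const_mul _ ?_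
    exact (isDerivTower_logTower l (i + 1) (z + 1) hz).comp_add_const z 1
  · funext z
    rw [h, hpc, Finset.sum_mul]
    simp only [zero_add, logTower_one, Function.iterate_zero, id_eq, mul_assoc]
  · simp only [iterate_derivative_eq_zero (show q.natDegree < k by omega), eval_zero, sub_zero]
    have := tendsto_finsetSum (Finset.range (n + 1)) fun l hl =>
      ((tendsto_logTower (j := l) (r := k + 1)
        (by have := Finset.mem_range.1 hl; omega)).comp tendsto_add_one_cobounded).const_mul (c l)
    simpa using this

theorem tendsto_stirlingTerm {n r : ℕ} (hr : 1 ≤ r) :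
    Tendsto (stirlingTerm n r) (Bornology.cobounded ℂ) (nhds 0) := by
  refine (isTheta_stirlingTerm hr).isBigO.trans_tendsto ?_
  have := (isLittleO_inv_pow (b := 0) (a := 2 * r - 1 - min (2 * r - 2) (n - 1)) (by omega))
  simp only [pow_zero, inv_one] at this
  exact (isLittleO_one_iff ℂ).1 this

theorem tendsto_logMultGamma_sub_stirlingMain {n : ℕ} (hn : 1 ≤ n) {δ : ℝ} (h0 : 0 < δ)
    (hpi : δ < Real.pi) :
    Tendsto (fun z => logMultGamma n z - stirlingMain n z) (atInftySector δ) (nhds 0) := by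
  have h1 := (isLittleO_logMultGamma (m := n) hn hn (by omega) h0 hpi).isBigO.trans_tendsto
    ((tendsto_stirlingTerm hn).mono_left (atInftySector_le δ))
  have h2 := tendsto_finsetSum (Finset.Icc 1 n) fun r hr =>
    (tendsto_stirlingTerm (n := n) (Finset.mem_Icc.1 hr).1).mono_left (atInftySector_le δ)
  have := h1.add h2
  simp only [Finset.sum_const_zero, add_zero] at this
  refine this.congr fun z => ?_
  ring

theorem isDerivTower_logMultGamma (n : ℕ) :
    IsDerivTower cutPlane (fun i => iteratedDeriv i (logMultGamma n)) :=
  IsDerivTower.of_differentiableOn isOpen_cutPlane (differentiableOn_logMultGamma n)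

theorem mem_cutPlane_of_neg_one_lt_re {z : ℂ} (hz : -1 < z.re) : z ∈ cutPlane := by
  change z + 1 ∈ Complex.slitPlane
  rw [Complex.mem_slitPlane_iff]
  left
  simp
  linarith

theorem tendsto_ofReal_cobounded : Tendsto (fun x : ℝ => (x : ℂ)) atTop (Bornology.cobounded ℂ) := by
  refine tendsto_norm_atTop_iff_cobounded.1 ?_
  simp only [Complex.norm_real]
  exact tendsto_norm_atTop_atTop

theorem iteratedDeriv_logMultGamma_zero (k : ℕ) {z : ℂ} (hz : z ∈ cutPlane) :
    iteratedDeriv k (logMultGamma 0) z = logTower 0 (k + 1) (z + 1) := by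
  have ht : IsDerivTower cutPlane (fun i z => logTower 0 (i + 1) (z + 1)) :=
    fun i z hz => (isDerivTower_logTower 0 (i + 1) (z + 1) hz).comp_add_const z 1
  rw [← ht.iteratedDeriv_eq isOpen_cutPlane k hz]
  congr 1
  funext z
  simp [logTower_one, logMultGamma]

/-- The difference from the main part tends to `0` in a sector. Being holomorphic, it has
derivatives that tend to `0` along the real axis, by Cauchy's estimate on unit circles; the
derivatives of the main part are explicit. -/
theorem tendsto_iteratedDeriv_logMultGamma {n k : ℕ} (hk : n + 1 ≤ k) :
    Tendsto (fun x : ℝ => iteratedDeriv k (logMultGamma n) x) atTop (nhds 0) := by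
  rcases Nat.eq_zero_or_pos n with rfl | hn
  · have h1 := ((tendsto_logTower (j := 0) (r := k + 1) (by omega)).comp
      tendsto_add_one_cobounded).comp tendsto_ofReal_cobounded
    refine h1.congr' ?_
    filter_upwards [eventually_ge_atTop 0] with x hx
    rw [iteratedDeriv_logMultGamma_zero k (mem_cutPlane_of_neg_one_lt_re (by simp; linarith))]
    rfl
  · obtain ⟨σ, hσ, hσ0, hσk⟩ := exists_tower_stirlingMain hn
    have hρ := (isDerivTower_logMultGamma n).sub hσ
    set ρ : ℂ → ℂ := fun z => logMultGamma n z - stirlingMain n z with hρdef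
    have hρ0 : (fun z => iteratedDeriv 0 (logMultGamma n) z - σ 0 z) = ρ := by
      funext z; rw [hσ0, iteratedDeriv_zero]
    have hρk : ∀ z ∈ cutPlane, iteratedDeriv k ρ z = iteratedDeriv k (logMultGamma n) z - σ k z := by
      intro z hz
      rw [← hρ0]
      exact hρ.iteratedDeriv_eq isOpen_cutPlane k hz
    have hdiff : ∀ z ∈ cutPlane, DifferentiableAt ℂ ρ z := by
      intro z hz
      rw [← hρ0]
      exact (hρ 0 z hz).differentiableAt
    have hlim : Tendsto (fun x : ℝ => iteratedDeriv k ρ x) atTop (nhds 0) := by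
      rw [Metric.tendsto_atTop]
      intro ε hε
      have h1 := tendsto_logMultGamma_sub_stirlingMain hn (δ := Real.pi / 2) (by positivity)
        (by linarith [Real.pi_pos])
      -- Cauchy's estimate on a circle of radius `1` costs `k!`, and the factor `1/2` makes the
      -- final inequality strict. The choice `δ = π/2` above makes the sector the right half-plane,
      -- where the discs about large `x` lie.
      have hε' : 0 < ε / 2 / (k.factorial : ℝ) := by positivity
      have h2 := (Metric.tendsto_nhds.1 h1) _ hε'
      rw [atInftySector, eventually_inf_principal,
        (hasBasis_cobounded_norm (E := ℂ)).eventually_iff] at h2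
      obtain ⟨R, -, hR⟩ := h2
      refine ⟨max R 0 + 2, fun x hx => ?_⟩
      have hx0 : 2 ≤ x := by linarith [le_max_right R 0]
      have hxR : R + 2 ≤ x := by linarith [le_max_left R 0]
      have hball : ∀ z ∈ Metric.closedBall (x : ℂ) 1, x - 1 ≤ z.re := by
        intro z hz
        have h3 := Complex.abs_re_le_norm (z - x)
        rw [Metric.mem_closedBall, Complex.dist_eq] at hz
        have h4 := (abs_le.1 (h3.trans hz)).1
        simp at h4
        linarith
      have hcau := Complex.norm_iteratedDeriv_le_of_forall_mem_sphere_norm_le (c := (x : ℂ)) (f := ρ)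
        (C := ε / 2 / (k.factorial : ℝ)) k one_pos ?_ ?_
      · rw [one_pow, div_one, mul_div_cancel₀ _ (by positivity)] at hcau
        rw [dist_zero_right]
        linarith
      · refine DifferentiableOn.diffContOnCl fun z hz => ?_
        rw [closure_ball _ one_ne_zero] at hz
        exact (hdiff z (mem_cutPlane_of_neg_one_lt_re
          (by linarith [hball z hz]))).differentiableWithinAt
      · intro z hz
        have hz' := hball z (Metric.sphere_subset_closedBall hz)
        have := hR (show R ≤ ‖z‖ from (by linarith : R ≤ z.re).trans (Complex.re_le_norm z)) ?_
        · rw [dist_zero_right] at this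
          exact this.le
        · change |z.arg| < Real.pi - Real.pi / 2
          rw [sub_half, Complex.abs_arg_lt_pi_div_two_iff]
          left
          linarith
    have := hlim.add ((hσk k hk).comp tendsto_ofReal_cobounded)
    rw [add_zero] at this
    refine this.congr' ?_
    filter_upwards [eventually_ge_atTop 0] with x hx
    rw [hρk x (mem_cutPlane_of_neg_one_lt_re (by simp; linarith))]
    simp

/-! ### Monotonicity and reality on the real axis -/

theorem cutPlane_add_one {z : ℂ} (hz : z ∈ cutPlane) : z + 1 ∈ cutPlane := by
  have := add_natCast_mem_slitPlane (a := z + 1) hz 1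
  rwa [Nat.cast_one] at this

theorem iteratedDeriv_logMultGamma_add_one (n k : ℕ) {z : ℂ} (hz : z ∈ cutPlane) :
    iteratedDeriv k (logMultGamma (n + 1)) (z + 1) - iteratedDeriv k (logMultGamma (n + 1)) z =
      iteratedDeriv k (logMultGamma n) z :=
  (isDerivTower_logMultGamma (n + 1)).step (isDerivTower_logMultGamma n) isOpen_cutPlane
    (fun _ => cutPlane_add_one) (fun z hz => by simpa using logMultGamma_add_one n hz) k z hz

theorem ofReal_mem_cutPlane {x : ℝ} (hx : -1 < x) : (x : ℂ) ∈ cutPlane :=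
  mem_cutPlane_of_neg_one_lt_re (by simpa using hx)

/-- Induction over all `i` at once: the sign for `i + 1` on level `n` says that the quantity for `i`
on level `n + 1` does not increase under `x ↦ x + 1`. It tends to `0` along `x + k`, hence is
nonnegative. -/
theorem iteratedDeriv_logMultGamma_sign (n i : ℕ) {x : ℝ} (hx : -1 < x) :
    0 ≤ (-1) ^ i * (iteratedDeriv (n + 1 + i) (logMultGamma n) x).re := by
  induction n generalizing i x with
  | zero =>
    have ht : IsDerivTower cutPlane (fun i z => logDivTower 0 i (z + 1)) := by
      intro i z hz
      refine (isDerivTower_logDivTower (z := 0) (by norm_num) i (z + 1) ?_).comp_add_const z 1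
      change (0 + (z + 1)) / (0 + 1) ∈ Complex.slitPlane
      rw [zero_add, zero_add, div_one]
      exact hz
    have e : logMultGamma 0 = fun z => logDivTower 0 0 (z + 1) := by
      funext z; simp [logMultGamma, logDivTower]
    rw [e, ht.iteratedDeriv_eq isOpen_cutPlane _ (ofReal_mem_cutPlane hx),
      show 0 + 1 + i = i + 1 by omega, logDivTower]
    have e2 : (-1) ^ i * (i.factorial : ℂ) * ((0 + ((x : ℂ) + 1)) ^ (i + 1))⁻¹ =
        (((-1) ^ i * (i.factorial : ℝ) * ((x + 1) ^ (i + 1))⁻¹ : ℝ) : ℂ) := by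
      push_cast
      rw [zero_add]
    rw [e2, Complex.ofReal_re, ← mul_assoc, ← mul_assoc, ← mul_pow]
    have : 0 < x + 1 := by linarith
    norm_num
    positivity
  | succ n ih =>
    set g : ℝ → ℝ := fun y => (-1) ^ i * (iteratedDeriv (n + 1 + 1 + i) (logMultGamma (n + 1)) y).re
      with hg
    have hstep : ∀ y : ℝ, -1 < y → g (y + 1) ≤ g y := by
      intro y hy
      have h1 := congrArg Complex.re
        (iteratedDeriv_logMultGamma_add_one n (n + 1 + 1 + i) (ofReal_mem_cutPlane hy))
      have h2 := ih (i + 1) hy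
      rw [show n + 1 + (i + 1) = n + 1 + 1 + i by omega, ← h1, Complex.sub_re, pow_succ] at h2
      simp only [hg]
      push_cast
      linarith
    have hk : ∀ k : ℕ, g (x + k) ≤ g x := by
      intro k
      induction k with
      | zero => simp
      | succ k ihk =>
        push_cast
        rw [← add_assoc]
        exact (hstep _ (by linarith [Nat.cast_nonneg (α := ℝ) k])).trans ihk
    have hlim : Tendsto (fun k : ℕ => g (x + k)) atTop (nhds 0) := by
      have h1 := (tendsto_iteratedDeriv_logMultGamma (n := n + 1) (k := n + 1 + 1 + i)
        (by omega)).comp (tendsto_atTop_add_const_left atTop x tendsto_natCast_atTop_atTop)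
      have h2 := ((Complex.continuous_re.tendsto 0).comp h1).const_mul ((-1) ^ i)
      simpa [hg, Function.comp_def] using h2
    exact le_of_tendsto' hlim hk

theorem logMultGamma_one_right (n : ℕ) : logMultGamma (n + 1) 1 = 0 := by
  have := logMultGamma_add_one n (z := 0) (by simp)
  rw [logMultGamma_zero_right, logMultGamma_zero_right, zero_add, sub_zero] at this
  exact this

/-- By induction the imaginary part is periodic on `(0, ∞)`. A high derivative of it is periodic and
tends to `0`, so it vanishes; the imaginary part is therefore constant, and it is zero at `1`. -/
theorem logMultGamma_im (n : ℕ) {x : ℝ} (hx : 0 ≤ x) : (logMultGamma n x).im = 0 := by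
  induction n generalizing x with
  | zero =>
    have : ((x : ℂ) + 1) = ((x + 1 : ℝ) : ℂ) := by push_cast; rfl
    rw [logMultGamma, this, Complex.log_im, Complex.arg_ofReal_of_nonneg (by positivity)]
  | succ n ih =>
    rcases hx.eq_or_lt with rfl | hx
    · simp [logMultGamma_zero_right]
    have ht := ((isDerivTower_logMultGamma (n + 1)).im).mono
      (t := Set.Ioi 0) fun y (hy : 0 < y) => ofReal_mem_cutPlane (by linarith)
    have hper : ∀ y : ℝ, 0 < y → (iteratedDeriv 0 (logMultGamma (n + 1)) ((y + 1 : ℝ) : ℂ)).im =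
        (iteratedDeriv 0 (logMultGamma (n + 1)) (y : ℂ)).im := by
      intro y hy
      have h1 := congrArg Complex.im
        (logMultGamma_add_one n (z := y) (ofReal_mem_cutPlane (by linarith)))
      rw [Complex.sub_im, ih hy.le, sub_eq_zero] at h1
      simpa using h1
    have hzero : ∀ y : ℝ, 0 < y → (iteratedDeriv (n + 1 + 1) (logMultGamma (n + 1)) (y : ℂ)).im = 0 := by
      intro y hy
      have h1 := (tendsto_iteratedDeriv_logMultGamma (n := n + 1) (k := n + 1 + 1)
        (by omega)).comp (tendsto_atTop_add_const_left atTop y tendsto_natCast_atTop_atTop)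
      have h2 := ((Complex.continuous_im.tendsto 0).comp h1)
      refine tendsto_nhds_unique ?_ h2
      refine tendsto_const_nhds.congr fun k => ?_
      exact (ht.periodic_natCast hper (n + 1 + 1) hy k).symm
    have := ht.eq_of_periodic hper (n := n + 1) (fun y hy => (hzero y hy).ge) hx one_pos
    simpa [logMultGamma_one_right] using this

/-! ### The domain of the multiple gamma functions -/

theorem gammaDomain_eq : gammaDomain = (Set.range fun k : ℕ => -(k : ℂ))ᶜ := by
  ext z
  simp [gammaDomain, eq_comm]

theorem isOpen_gammaDomain : IsOpen gammaDomain := by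
  have h : (Set.range fun k : ℕ => -(k : ℂ)) =
      (fun m : ℤ => (m : ℂ)) '' (Set.range fun k : ℕ => -(k : ℤ)) := by
    rw [← Set.range_comp]
    congr 1
    funext k
    simp
  rw [gammaDomain_eq, h, isOpen_compl_iff]
  exact Complex.isClosedEmbedding_intCast.isClosedMap _ (isClosed_discrete _)

theorem isPreconnected_gammaDomain : IsPreconnected gammaDomain := by
  rw [gammaDomain_eq]
  exact ((Set.countable_range _).isPathConnected_compl_of_one_lt_rank
    (by simp [Complex.rank_real_complex])).isConnected.isPreconnected

theorem slitPlane_subset_gammaDomain : Complex.slitPlane ⊆ gammaDomain := by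
  intro z hz k hk
  rw [hk, Complex.mem_slitPlane_iff] at hz
  simp at hz
  linarith [Nat.cast_nonneg (α := ℝ) k]

theorem add_natCast_mem_gammaDomain {z : ℂ} (hz : z ∈ gammaDomain) (m : ℕ) :
    z + m ∈ gammaDomain := by
  intro k hk
  refine hz (k + m) ?_
  push_cast
  linear_combination hk

theorem add_one_mem_gammaDomain {z : ℂ} (hz : z ∈ gammaDomain) : z + 1 ∈ gammaDomain := by
  exact_mod_cast add_natCast_mem_gammaDomain hz 1

theorem ofReal_add_one_mem_slitPlane {x : ℝ} (hx : -1 < x) : (x : ℂ) + 1 ∈ Complex.slitPlane :=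
  ofReal_mem_cutPlane hx

/-- The identity theorem on `gammaDomain`. -/
theorem eqOn_gammaDomain {f g : ℂ → ℂ} (hf : DifferentiableOn ℂ f gammaDomain)
    (hg : DifferentiableOn ℂ g gammaDomain) (h : ∀ x : ℝ, 0 < x → f (x + 1) = g (x + 1)) :
    Set.EqOn f g gammaDomain := by
  have hmem : (((1 : ℝ) : ℂ) + 1) ∈ gammaDomain :=
    slitPlane_subset_gammaDomain (ofReal_add_one_mem_slitPlane (by norm_num))
  refine AnalyticOnNhd.eqOn_of_preconnected_of_frequently_eq (hf.analyticOnNhd isOpen_gammaDomain)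
    (hg.analyticOnNhd isOpen_gammaDomain) isPreconnected_gammaDomain hmem ?_
  have ht : Tendsto (fun x : ℝ => (x : ℂ) + 1) (nhdsWithin 1 {1}ᶜ)
      (nhdsWithin (((1 : ℝ) : ℂ) + 1) {((1 : ℝ) : ℂ) + 1}ᶜ) := by
    refine tendsto_nhdsWithin_of_tendsto_nhds_of_eventually_within _ ?_ ?_
    · exact ((Complex.continuous_ofReal.add continuous_const).tendsto (1 : ℝ)).mono_left
        nhdsWithin_le_nhds
    · filter_upwards [self_mem_nhdsWithin] with x hx h
      refine hx ?_
      have := add_right_cancel (Set.mem_singleton_iff.1 h)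
      exact_mod_cast this
  refine ht.frequently (Eventually.frequently ?_)
  filter_upwards [nhdsWithin_le_nhds (Ioi_mem_nhds one_pos)] with x hx
  exact h x hx

/-! ### The multiple gamma functions -/

/-- A shift which moves `z` into the right half-plane. -/
noncomputable def shiftIndex (z : ℂ) : ℕ := ⌈|z.re|⌉₊ + 1

theorem add_shiftIndex_mem_slitPlane (z : ℂ) : z + shiftIndex z ∈ Complex.slitPlane := by
  rw [Complex.mem_slitPlane_iff]
  left
  have h1 := Nat.le_ceil |z.re|
  have h2 := neg_abs_le z.re
  simp [shiftIndex]
  linarith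

/-- Vignéras' multiple gamma functions. -/
noncomputable def multGamma : ℕ → ℂ → ℂ
  | 0, z => z
  | n + 1, z => Complex.exp (logMultGamma (n + 1) (z + shiftIndex z - 1)) /
      ∏ k ∈ Finset.range (shiftIndex z), multGamma n (z + k)

/-- The four facts go through the induction together: the next level divides by values of this one,
and the exponential formula is what makes the quotient independent of the chosen shift. -/
theorem multGamma_aux (n : ℕ) : DifferentiableOn ℂ (multGamma n) gammaDomain ∧
    (∀ z ∈ gammaDomain, multGamma n z ≠ 0) ∧
    (∀ z ∈ Complex.slitPlane, multGamma n z = Complex.exp (logMultGamma n (z - 1))) ∧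
    ∀ z ∈ gammaDomain, multGamma (n + 1) (z + 1) = multGamma n z * multGamma (n + 1) z := by
  have key : ∀ n, (∀ z ∈ gammaDomain, multGamma n z ≠ 0) →
      (∀ z ∈ Complex.slitPlane, multGamma n z = Complex.exp (logMultGamma n (z - 1))) →
      ∀ z ∈ gammaDomain, ∀ N : ℕ, z + N ∈ Complex.slitPlane → multGamma (n + 1) z =
        Complex.exp (logMultGamma (n + 1) (z + N - 1)) /
          ∏ k ∈ Finset.range N, multGamma n (z + k) := by
    intro n hne hexp z hz
    have hP : ∀ N : ℕ, ∏ k ∈ Finset.range N, multGamma n (z + k) ≠ 0 := fun N =>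
      Finset.prod_ne_zero_iff.2 fun k _ => hne _ (add_natCast_mem_gammaDomain hz k)
    -- Increasing the shift by one multiplies numerator and denominator by the same value of level
    -- `n`. Any two admissible shifts are compared through their sum.
    have hm : ∀ N : ℕ, z + N ∈ Complex.slitPlane → ∀ m : ℕ,
        Complex.exp (logMultGamma (n + 1) (z + (N + m : ℕ) - 1)) /
          ∏ k ∈ Finset.range (N + m), multGamma n (z + k) =
        Complex.exp (logMultGamma (n + 1) (z + N - 1)) /
          ∏ k ∈ Finset.range N, multGamma n (z + k) := by
      intro N hN m
      induction m with
      | zero => rfl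
      | succ m ih =>
        rw [← ih]
        have hs : z + (N + m : ℕ) ∈ Complex.slitPlane := by
          rw [Nat.cast_add, ← add_assoc]
          exact add_natCast_mem_slitPlane hN m
        have h1 := logMultGamma_add_one n (z := z + (N + m : ℕ) - 1) (by rwa [sub_add_cancel])
        rw [sub_add_cancel, sub_eq_iff_eq_add] at h1
        rw [← add_assoc N m 1, Finset.prod_range_succ, hexp _ hs, Nat.cast_succ (N + m), ← add_assoc z,
          add_sub_cancel_right, h1, Complex.exp_add]
        have := hP (N + m)
        have := Complex.exp_ne_zero (logMultGamma n (z + (N + m : ℕ) - 1))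
        field_simp
    intro N hN
    rw [multGamma, ← hm N hN (shiftIndex z), ← hm _ (add_shiftIndex_mem_slitPlane z) N,
      add_comm (shiftIndex z) N]
  have hstep : ∀ n, (∀ z ∈ gammaDomain, multGamma n z ≠ 0) →
      (∀ z ∈ Complex.slitPlane, multGamma n z = Complex.exp (logMultGamma n (z - 1))) →
      ∀ z ∈ gammaDomain, multGamma (n + 1) (z + 1) = multGamma n z * multGamma (n + 1) z := by
    intro n hne hexp z hz
    have h1 := add_shiftIndex_mem_slitPlane (z + 1)
    set N := shiftIndex (z + 1)
    have h2 : z + (N + 1 : ℕ) ∈ Complex.slitPlane := by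
      push_cast
      rwa [add_comm (N : ℂ) 1, ← add_assoc]
    rw [key n hne hexp (z + 1) (add_one_mem_gammaDomain hz) N h1, key n hne hexp z hz (N + 1) h2,
      Finset.prod_range_succ']
    have e : ∀ k : ℕ, z + ((k + 1 : ℕ) : ℂ) = z + 1 + k := fun k => by push_cast; ring
    simp only [e, Nat.cast_zero, add_zero]
    have := hne z hz
    have hP : ∏ k ∈ Finset.range N, multGamma n (z + 1 + k) ≠ 0 :=
      Finset.prod_ne_zero_iff.2 fun k _ =>
        hne _ (add_natCast_mem_gammaDomain (add_one_mem_gammaDomain hz) k)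
    field_simp
  induction n with
  | zero =>
    have hne : ∀ z ∈ gammaDomain, multGamma 0 z ≠ 0 := fun z hz h => hz 0 (by simpa [multGamma] using h)
    have hexp : ∀ z ∈ Complex.slitPlane, multGamma 0 z = Complex.exp (logMultGamma 0 (z - 1)) := by
      intro z hz
      rw [multGamma, logMultGamma, sub_add_cancel, Complex.exp_log (Complex.slitPlane_ne_zero hz)]
    refine ⟨?_, hne, hexp, hstep 0 hne hexp⟩
    exact differentiableOn_id.congr fun z _ => by simp [multGamma]
  | succ n ih =>
    obtain ⟨hd, hne, hexp, -⟩ := ih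
    have hkey := key n hne hexp
    have hne' : ∀ z ∈ gammaDomain, multGamma (n + 1) z ≠ 0 := by
      intro z hz
      rw [multGamma]
      exact div_ne_zero (Complex.exp_ne_zero _) (Finset.prod_ne_zero_iff.2 fun k _ =>
        hne _ (add_natCast_mem_gammaDomain hz k))
    have hexp' : ∀ z ∈ Complex.slitPlane,
        multGamma (n + 1) z = Complex.exp (logMultGamma (n + 1) (z - 1)) := by
      intro z hz
      have := hkey z (slitPlane_subset_gammaDomain hz) 0 (by simpa using hz)
      simpa using this
    refine ⟨?_, hne', hexp', hstep (n + 1) hne' hexp'⟩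
    intro z hz
    set N := shiftIndex z with hN
    -- `shiftIndex` jumps, but near `z` the fixed shift `N` stays admissible, so the function is
    -- locally one holomorphic quotient.
    have hcont : ContinuousAt (fun w : ℂ => w + N) z := by fun_prop
    have hev : ∀ᶠ w in nhds z, multGamma (n + 1) w =
        Complex.exp (logMultGamma (n + 1) (w + N - 1)) /
          ∏ k ∈ Finset.range N, multGamma n (w + k) := by
      filter_upwards [isOpen_gammaDomain.mem_nhds hz, hcont (Complex.isOpen_slitPlane.mem_nhds
        (add_shiftIndex_mem_slitPlane z))] with w hw hw'
      exact hkey w hw N hw'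
    refine DifferentiableAt.differentiableWithinAt ?_
    refine DifferentiableAt.congr_of_eventuallyEq ?_ hev
    refine DifferentiableAt.div ?_ ?_ (Finset.prod_ne_zero_iff.2 fun k _ =>
        hne _ (add_natCast_mem_gammaDomain hz k))
    · refine DifferentiableAt.cexp (DifferentiableAt.fun_comp' z ?_ (by fun_prop))
      refine (differentiableOn_logMultGamma (n + 1)).differentiableAt (isOpen_cutPlane.mem_nhds ?_)
      change z + N - 1 + 1 ∈ Complex.slitPlane
      rw [sub_add_cancel]
      exact add_shiftIndex_mem_slitPlane z
    · refine DifferentiableAt.fun_finsetProd fun k _ => ?_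
      exact DifferentiableAt.fun_comp' z (hd.differentiableAt
        (isOpen_gammaDomain.mem_nhds (add_natCast_mem_gammaDomain hz k))) (by fun_prop)

theorem differentiableOn_multGamma (n : ℕ) : DifferentiableOn ℂ (multGamma n) gammaDomain :=
  (multGamma_aux n).1

theorem multGamma_step (n : ℕ) {z : ℂ} (hz : z ∈ gammaDomain) :
    multGamma (n + 1) (z + 1) = multGamma n z * multGamma (n + 1) z :=
  (multGamma_aux n).2.2.2 z hz

theorem exp_logMultGamma (n : ℕ) {z : ℂ} (hz : z ∈ cutPlane) :
    Complex.exp (logMultGamma n z) = multGamma n (z + 1) := by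
  rw [(multGamma_aux n).2.2.1 _ hz, add_sub_cancel_right]

theorem isLogBranch_logMultGamma (n : ℕ) : IsLogBranch (multGamma n) (logMultGamma n) :=
  ⟨differentiableOn_logMultGamma n, fun _ hz => exp_logMultGamma n hz, logMultGamma_zero_right n⟩

theorem logMultGamma_ofReal (n : ℕ) {x : ℝ} (hx : 0 ≤ x) :
    logMultGamma n x = ((logMultGamma n x).re : ℂ) :=
  Complex.ext rfl (by rw [logMultGamma_im n hx, Complex.ofReal_im])

theorem multGamma_ofReal (n : ℕ) {x : ℝ} (hx : 0 ≤ x) :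
    multGamma n (x + 1) = (Real.exp (logMultGamma n x).re : ℂ) := by
  rw [← exp_logMultGamma n (ofReal_mem_cutPlane (by linarith)), logMultGamma_ofReal n hx]
  simp

theorem log_norm_multGamma (n : ℕ) {x : ℝ} (hx : -1 < x) :
    Real.log ‖multGamma n (x + 1)‖ = (logMultGamma n x).re := by
  rw [← exp_logMultGamma n (ofReal_mem_cutPlane hx), Complex.norm_exp, Real.log_exp]

theorem isDerivTower_re_logMultGamma (n : ℕ) : IsDerivTower (Set.Ioi (-1))
    (fun i (x : ℝ) => (iteratedDeriv i (logMultGamma n) x).re) :=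
  (isDerivTower_logMultGamma n).re.mono fun _ hx => ofReal_mem_cutPlane hx

theorem iteratedDeriv_log_norm_multGamma (n k : ℕ) {x : ℝ} (hx : -1 < x) :
    iteratedDeriv k (fun t : ℝ => Real.log ‖multGamma n (t + 1)‖) x =
      (iteratedDeriv k (logMultGamma n) x).re := by
  rw [← (isDerivTower_re_logMultGamma n).iteratedDeriv_eq isOpen_Ioi k hx]
  refine Filter.EventuallyEq.iteratedDeriv_eq k ?_
  filter_upwards [Ioi_mem_nhds hx] with y hy
  rw [log_norm_multGamma n hy, iteratedDeriv_zero]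

/-- The functional equation carries reality from `[0, ∞)` back to `(-1, 0)`; the factor divided by
is nonzero. -/
theorem multGamma_im_eq_zero (n : ℕ) {x : ℝ} (hx : -1 < x) : (multGamma n (x + 1)).im = 0 := by
  induction n with
  | zero => simp [multGamma]
  | succ n ih =>
    have h1 := multGamma_step n (slitPlane_subset_gammaDomain (ofReal_add_one_mem_slitPlane hx))
    have h2 := multGamma_ofReal (n + 1) (x := x + 1) (by linarith)
    rw [Complex.ofReal_add, Complex.ofReal_one, h1] at h2
    have h3 := (multGamma_aux n).2.1 _
      (slitPlane_subset_gammaDomain (ofReal_add_one_mem_slitPlane hx))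
    have h4 : multGamma n ((x : ℂ) + 1) = ((multGamma n ((x : ℂ) + 1)).re : ℂ) :=
      Complex.ext rfl (by rw [ih, Complex.ofReal_im])
    rw [h4] at h2 h3
    rw [mul_comm, ← eq_div_iff h3, ← Complex.ofReal_div] at h2
    rw [h2, Complex.ofReal_im]

/-- The convexity condition at `x = 0` involves a two-sided neighbourhood, hence the range `x > -1`.
`Real.log` sees only the absolute value, so reality on `(-1, 0)` suffices and no sign is needed
there. -/
theorem iteratedDeriv_log_re_multGamma (n k : ℕ) {x : ℝ} (hx : -1 < x) :
    iteratedDeriv k (fun t : ℝ => Real.log (multGamma n (t + 1)).re) x =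
      (iteratedDeriv k (logMultGamma n) x).re := by
  rw [← iteratedDeriv_log_norm_multGamma n k hx]
  refine Filter.EventuallyEq.iteratedDeriv_eq k ?_
  filter_upwards [Ioi_mem_nhds hx] with y hy
  rw [← Complex.abs_re_eq_norm.2 (multGamma_im_eq_zero n hy), Real.log_abs]

theorem isMultipleGammaHierarchy_multGamma : IsMultipleGammaHierarchy multGamma where
  holomorphic := differentiableOn_multGamma
  step n _ hz := multGamma_step n hz
  one n := by
    have := multGamma_ofReal n (x := 0) le_rfl
    simpa [logMultGamma_zero_right] using this
  real n x hx := by rw [multGamma_ofReal n hx, Complex.ofReal_im]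
  pos n x hx := by
    rw [multGamma_ofReal n hx, Complex.ofReal_re]
    exact Real.exp_pos _
  convex n x hx := by
    rw [iteratedDeriv_log_re_multGamma n _ (by linarith)]
    simpa using iteratedDeriv_logMultGamma_sign n 0 (x := x) (by linarith)
  zero _ _ := by rw [multGamma]

/-! ### Uniqueness -/

theorem contDiffOn_log_re {f : ℂ → ℂ} (hf : DifferentiableOn ℂ f gammaDomain)
    (hpos : ∀ x : ℝ, 0 ≤ x → 0 < (f (x + 1)).re) :
    ContDiffOn ℝ (⊤ : ℕ∞) (fun t : ℝ => Real.log (f (t + 1)).re) (Set.Ioi 0) := by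
  intro x hx
  refine ContDiffAt.contDiffWithinAt ?_
  have hx : (0 : ℝ) < x := hx
  refine ContDiffAt.log ?_ (hpos x hx.le).ne'
  have h1 : ContDiffAt ℂ (⊤ : ℕ∞) f ((x : ℂ) + 1) :=
    (hf.contDiffOn isOpen_gammaDomain).contDiffAt (isOpen_gammaDomain.mem_nhds
      (slitPlane_subset_gammaDomain (ofReal_add_one_mem_slitPlane (by linarith))))
  have h2 : ContDiffAt ℝ (⊤ : ℕ∞) (fun t : ℝ => (t : ℂ) + 1) x :=
    (Complex.ofRealCLM.contDiff.add contDiff_const).contDiffAt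
  exact Complex.reCLM.contDiff.contDiffAt.comp x ((h1.restrict_scalars ℝ).comp x h2)

/-- By induction the lower levels agree, so on `(0, ∞)` the logarithms of the two candidates differ
by a `1`-periodic function. It is constant by `IsDerivTower.eq_of_periodic`, and the identity
theorem passes from the half-line to the domain. -/
theorem IsMultipleGammaHierarchy.eqOn {H : ℕ → ℂ → ℂ} (hH : IsMultipleGammaHierarchy H) (n : ℕ) :
    Set.EqOn (H n) (multGamma n) gammaDomain := by
  induction n with
  | zero => intro z hz; rw [hH.zero z hz, multGamma]
  | succ n ih =>
    have hu : IsDerivTower (Set.Ioi (0 : ℝ))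
        (fun i => iteratedDeriv i (fun t : ℝ => Real.log (H (n + 1) (t + 1)).re)) :=
      IsDerivTower.of_contDiffOn isOpen_Ioi
        (contDiffOn_log_re (hH.holomorphic (n + 1)) (hH.pos (n + 1)))
    have hv : IsDerivTower (Set.Ioi (0 : ℝ))
        (fun i (x : ℝ) => (iteratedDeriv i (logMultGamma (n + 1)) x).re) :=
      (isDerivTower_re_logMultGamma (n + 1)).mono fun x (hx : 0 < x) => lt_trans (by norm_num) hx
    have hd := hu.sub hv
    have hre : ∀ k, ∀ x : ℝ, 0 ≤ x → H k (x + 1) = ((H k (x + 1)).re : ℂ) := fun k x hx =>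
      Complex.ext rfl (by rw [hH.real k x hx, Complex.ofReal_im])
    have hstepH : ∀ x : ℝ, 0 ≤ x → Real.log (H (n + 1) ((x + 1 : ℝ) + 1)).re =
        (logMultGamma n x).re + Real.log (H (n + 1) (x + 1)).re := by
      intro x hx
      have hmem := slitPlane_subset_gammaDomain (ofReal_add_one_mem_slitPlane (x := x) (by linarith))
      have h1 := hH.step n _ hmem
      rw [ih hmem, multGamma_ofReal n hx, hre (n + 1) x hx,
        ← Complex.ofReal_mul] at h1
      push_cast
      rw [h1, Complex.ofReal_re, Real.log_mul (Real.exp_ne_zero _) (hH.pos _ x hx).ne', Real.log_exp]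
    have hper : ∀ x : ℝ, 0 < x →
        iteratedDeriv 0 (fun t : ℝ => Real.log (H (n + 1) (t + 1)).re) (x + 1) -
          (iteratedDeriv 0 (logMultGamma (n + 1)) ((x + 1 : ℝ) : ℂ)).re =
        iteratedDeriv 0 (fun t : ℝ => Real.log (H (n + 1) (t + 1)).re) x -
          (iteratedDeriv 0 (logMultGamma (n + 1)) (x : ℂ)).re := by
      intro x hx
      have h1 := congrArg Complex.re
        (logMultGamma_add_one n (z := x) (ofReal_mem_cutPlane (by linarith)))
      rw [Complex.sub_re] at h1
      simp only [iteratedDeriv_zero]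
      rw [hstepH x hx.le]
      push_cast
      linarith
    -- By periodicity the difference may be evaluated at `x + k`. There the derivative of `log H` is
    -- nonnegative by convexity, and the other one tends to `0` as `k → ∞`.
    have hnonneg : ∀ x : ℝ, 0 < x →
        0 ≤ iteratedDeriv (n + 1 + 1) (fun t : ℝ => Real.log (H (n + 1) (t + 1)).re) x -
          (iteratedDeriv (n + 1 + 1) (logMultGamma (n + 1)) (x : ℂ)).re := by
      intro x hx
      have h1 := (tendsto_iteratedDeriv_logMultGamma (n := n + 1) (k := n + 1 + 1) le_rfl).comp
        (tendsto_atTop_add_const_left atTop x tendsto_natCast_atTop_atTop)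
      have h2 := ((Complex.continuous_re.tendsto 0).comp h1).neg
      rw [Complex.zero_re, neg_zero] at h2
      refine le_of_tendsto' h2 fun k => ?_
      rw [← hd.periodic_natCast hper (n + 1 + 1) hx k]
      have := hH.convex (n + 1) (x + k) (by positivity)
      simp only [Function.comp_apply]
      linarith
    -- The comparison lives on the open half-line, so the normalisation at `0` is first moved to `1`
    -- by the functional equation.
    have hone : Real.log (H (n + 1) ((1 : ℝ) + 1)).re = 0 := by
      have h1 := hstepH 0 le_rfl
      simpa [logMultGamma_zero_right, hH.one] using h1
    refine eqOn_gammaDomain (hH.holomorphic _) (differentiableOn_multGamma _) fun x hx => ?_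
    have h1 := hd.eq_of_periodic hper hnonneg hx one_pos
    simp only [iteratedDeriv_zero] at h1
    rw [hone, Complex.ofReal_one, logMultGamma_one_right, Complex.zero_re, sub_zero,
      sub_eq_zero] at h1
    rw [multGamma_ofReal _ hx.le, hre _ x hx.le, ← h1,
      Real.exp_log (hH.pos _ x hx.le)]

/-! ### The first level is the gamma function -/

/-- The Bohr-Mollerup theorem for the real function `y ↦ |G_1(y)|`; its logarithmic convexity is the
case of level `1` and `i = 0` in `iteratedDeriv_logMultGamma_sign`. -/
theorem norm_multGamma_one {y : ℝ} (hy : 0 < y) : ‖multGamma 1 y‖ = Real.Gamma y := by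
  have hslit : ∀ y : ℝ, 0 < y → (y : ℂ) ∈ gammaDomain := fun y hy =>
    slitPlane_subset_gammaDomain (Complex.ofReal_mem_slitPlane.2 hy)
  refine Real.eq_Gamma_of_log_convex (f := fun y : ℝ => ‖multGamma 1 y‖) ?_ ?_ ?_ ?_ hy
  · have ht : IsDerivTower (Set.Ioi (0 : ℝ))
        (fun i (y : ℝ) => (iteratedDeriv i (logMultGamma 1) ((y - 1 : ℝ) : ℂ)).re) := by
      intro i y hy
      have hy : 0 < y := hy
      exact (isDerivTower_re_logMultGamma 1 i (y - 1)
        (show -1 < y - 1 by linarith)).comp_sub_const y 1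
    have hlog : ∀ y ∈ Set.Ioi (0 : ℝ), (Real.log ∘ fun y : ℝ => ‖multGamma 1 y‖) y =
        (iteratedDeriv 0 (logMultGamma 1) ((y - 1 : ℝ) : ℂ)).re := by
      intro y hy
      have hy : 0 < y := hy
      have := log_norm_multGamma 1 (x := y - 1) (by linarith)
      rw [iteratedDeriv_zero, ← this]
      simp
    refine ConvexOn.congr ?_ fun y hy => (hlog y hy).symm
    have hder : ∀ i, ∀ y ∈ Set.Ioi (0 : ℝ), deriv (fun y : ℝ =>
        (iteratedDeriv i (logMultGamma 1) ((y - 1 : ℝ) : ℂ)).re) y =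
        (iteratedDeriv (i + 1) (logMultGamma 1) ((y - 1 : ℝ) : ℂ)).re :=
      fun i y hy => (ht i y hy).deriv
    have hdiff : DifferentiableOn ℝ (deriv fun y : ℝ =>
        (iteratedDeriv 0 (logMultGamma 1) ((y - 1 : ℝ) : ℂ)).re) (Set.Ioi 0) :=
      DifferentiableOn.congr (fun y hy => (ht 1 y hy).differentiableAt.differentiableWithinAt)
        (hder 0)
    refine convexOn_of_deriv2_nonneg (convex_Ioi 0)
      (fun y hy => (ht 0 y hy).continuousAt.continuousWithinAt) ?_ ?_ fun y hy => ?_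
    · rw [interior_Ioi]
      exact fun y hy => (ht 0 y hy).differentiableAt.differentiableWithinAt
    · rwa [interior_Ioi]
    · rw [interior_Ioi] at hy
      have hy' : 0 < y := hy
      change 0 ≤ deriv (deriv _) y
      have hev : (deriv fun y : ℝ => (iteratedDeriv 0 (logMultGamma 1) ((y - 1 : ℝ) : ℂ)).re) =ᶠ[nhds y]
          fun y : ℝ => (iteratedDeriv 1 (logMultGamma 1) ((y - 1 : ℝ) : ℂ)).re :=
        Filter.eventually_of_mem (Ioi_mem_nhds hy') (hder 0)
      rw [hev.deriv_eq, hder 1 y hy]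
      simpa using iteratedDeriv_logMultGamma_sign 1 0 (x := y - 1) (by linarith)
  · intro y hy
    have := multGamma_step 0 (hslit y hy)
    push_cast
    rw [this, norm_mul, multGamma, Complex.norm_real, Real.norm_of_nonneg hy.le]
  · exact fun {y} hy => norm_pos_iff.2 ((multGamma_aux 1).2.1 _ (hslit y hy))
  · have := isMultipleGammaHierarchy_multGamma.one 1
    simp [this]

theorem multGamma_one_eqOn : Set.EqOn (multGamma 1) Complex.Gamma gammaDomain := by
  refine eqOn_gammaDomain (differentiableOn_multGamma 1)
    (fun z hz => (Complex.differentiableAt_Gamma z hz).differentiableWithinAt) fun x hx => ?_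
  have h1 := norm_multGamma_one (y := x + 1) (by linarith)
  have h2 := multGamma_ofReal 1 hx.le
  rw [Complex.ofReal_add, Complex.ofReal_one, h2, Complex.norm_real,
    Real.norm_of_nonneg (Real.exp_pos _).le] at h1
  rw [h2, h1, ← Complex.Gamma_ofReal]
  push_cast
  rfl

theorem theorem4p5 :
    ∃ G : ℕ → ℂ → ℂ,
      -- `G` is the unique hierarchy of multiple gamma functions
      (IsMultipleGammaHierarchy G ∧
        ∀ H : ℕ → ℂ → ℂ, IsMultipleGammaHierarchy H → ∀ n, Set.EqOn (H n) (G n) gammaDomain) ∧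
      -- the higher Stirling formula
      (∀ n : ℕ, 1 ≤ n → ∃ L : ℂ → ℂ, IsLogBranch (G n) L ∧
        ∀ δ : ℝ, 0 < δ → δ < Real.pi →
          (∀ m : ℕ, n < 2 * m →
            stirlingF n (2 * m + 1) =O[atInftySector δ]
              fun z => (z ^ 2)⁻¹ * stirlingF n (2 * m - 1) z) ∧
          (∀ m : ℕ, 1 ≤ m → n ≤ 2 * m →
            (fun z => L z - (stirlingMain n z + ∑ r ∈ Finset.Icc 1 m, stirlingTerm n r z))
              =o[atInftySector δ] stirlingTerm n m)) ∧
      -- the case `n = 1` is Stirling's formula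
      (Set.EqOn (G 1) Complex.Gamma gammaDomain ∧
        (∀ z : ℂ, z + 1 ∈ Complex.slitPlane →
          stirlingMain 1 z
            = (z + 1 / 2) * Complex.log (z + 1) - (z + 1) - deriv riemannZeta 0) ∧
        (∀ r : ℕ, 1 ≤ r → ∀ z : ℂ, z + 1 ∈ Complex.slitPlane →
          stirlingTerm 1 r z
            = (_root_.bernoulli (2 * r) : ℂ) / (2 * r * (2 * r - 1)) * (1 / (z + 1) ^ (2 * r - 1)))) ∧
      -- the case `n = 2` is the asymptotic formula for the Barnes `G`-function
      ∃ L : ℂ → ℂ, IsLogBranch (G 2) L ∧ ∀ δ : ℝ, 0 < δ → δ < Real.pi →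
        (fun z => L z - ((z ^ 2 / 2 - 1 / 12) * Complex.log (z + 1)
            - 3 / 4 * z ^ 2 - z / 2 + 1 / 4 - z * deriv riemannZeta 0 + deriv riemannZeta (-1)))
          =O[atInftySector δ] fun z => 1 / z := by
  refine ⟨multGamma, ⟨isMultipleGammaHierarchy_multGamma, fun H hH n => hH.eqOn n⟩,
    fun n hn => ⟨logMultGamma n, isLogBranch_logMultGamma n, fun δ h0 hpi =>
      ⟨fun m hm => isBigO_stirlingF_step hn hm,
        fun m hm hnm => isLittleO_logMultGamma hn hm hnm h0 hpi⟩⟩,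
    ⟨multGamma_one_eqOn, fun z _ => stirlingMain_one z,
      fun r hr z hz => stirlingTerm_one hr (Complex.slitPlane_ne_zero hz)⟩,
    logMultGamma 2, isLogBranch_logMultGamma 2, fun δ h0 hpi => isBigO_logMultGamma_two h0 hpi⟩
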